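/- Let two particles of distinct masses $\mu_1,\mu_2>0$, $\mu_1\neq\mu_2$, move on the unit sphere $S\subset\mathbb R^3$, with Lagrangian $\tfrac12\mu_1\|\dot x_1\|^2+\tfrac12\mu_2\|\dot x_2\|^2-V(q)$, where $q\in(0,\pi)$ is their geodesic distance, $\cos q=x_1\cdot x_2$, and $V$ is a smooth repelling potential on $(0,\pi)$, that is $V'(q)<0$ for all $q\in(0,\pi)$. A relative equilibrium (RE) is a motion that is an orbit of a one-parameter subgroup of $SO(3)$, that is, a rotation of both particles about a fixed axis with constant angular velocity vector $\omega\in\mathbb R^3$. (i) For each $q\in(0,\pi)$ with $q\neq\pi/2$ there is an RE in which the particles are separated by the angle $q$, and it is unique up to rotations of the sphere and reversal of time. There is no RE with $q=\pi/2$. (ii) In every RE the axis of rotation subtends angles $\theta_1,\theta_2\in(0,\pi/2)$ with the particles of mass $\mu_1,\mu_2$ respectively, the particles lie in opposite open hemispheres with respect to the axis, and $$q=\pi-(\theta_1+\theta_2),\qquad \mu_1\sin 2\theta_1=\mu_2\sin 2\theta_2 .$$ In the acute RE ($q<\pi/2$) the smaller mass is closer to the axis of rotation, and in the obtuse RE ($q>\pi/2$)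 the larger mass is closer to it. The angular velocity satisfies $$\|\omega\|^2=-\zeta^{-1}V'(q),\qquad \zeta=\tfrac12\mu_1\sin 2\theta_1=\tfrac12\mu_2\sin 2\theta_2 .$$ (iii) Let $V(q)=\cot q$, and consider the linearization at the RE of the reduced system on the 5-dimensional quotient by $SO(3)$ of the phase space. The RE is called elliptic if this linearization is diagonalizable over $\mathbb C$ with all its eigenvalues on the imaginary axis and with $0$ a simple eigenvalue (so that the four eigenvalues along the symplectic leaf are purely imaginary and nonzero), and linearly unstable if it has an eigenvalue with positive real part. Every obtuse RE is elliptic. Put $\mu=\min(\mu_1,\mu_2)/\max(\mu_1,\mu_2)$. The equation $$\cos 2\alpha=2\sin^2\alpha\,\sqrt{1-\mu^2\sin^2 2\alpha}$$ has a unique solution $\alpha^\dagger\in(\pi/2,\pi)$; the number $$q^\dagger=\alpha^\dagger-\frac{\pi}{2}-\frac12\arcsin(\mu\sin 2\alpha^\dagger)$$ lies in $(0,\pi/2)$; and the acute RE are linearly unstable for $0<q<q^\dagger$ and elliptic for $q^\dagger<q<\pi/2$. -/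

import Mathlib

open Set Real

noncomputable section

namespace TwoBody

/-- The ambient Euclidean space `ℝ³` of the unit sphere. -/
abbrev E3 : Type := EuclideanSpace ℝ (Fin 3)

/-- The vector product of `ℝ³`. -/
def cross (u v : E3) : E3 := WithLp.toLp 2 (crossProduct u.ofLp v.ofLp)

/-- The element `x ↦ ω × x` of the Lie algebra `𝔰𝔬(3)` with angular velocity vector `ω`. -/
def rotGen (ω : E3) : E3 →L[ℝ] E3 :=
  LinearMap.toContinuousLinearMap
    { toFun := fun x => cross ω x
      map_add' := fun x y => by simp [cross]
      map_smul' := fun c x => by simp [cross] }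

/-- The geodesic distance on the unit sphere: the `q ∈ [0, π]` with `cos q = x ⬝ y`. -/
def geoDist (x y : E3) : ℝ := Real.arccos (inner ℝ x y)

/-- A repelling potential: a smooth function of the distance `q ∈ (0, π)` with `V' < 0`. -/
def IsRepelling (V : ℝ → ℝ) : Prop :=
  ContDiffOn ℝ ((⊤ : ℕ∞) : WithTop ℕ∞) V (Ioo 0 π) ∧ ∀ q ∈ Ioo 0 π, deriv V q < 0

/-- The curve `(x₁, x₂)` is a motion of two particles of masses `μ₁, μ₂` on the unit sphere with
potential energy `V (q)`, where `q` is their geodesic distance (collisions and antipodal pairs are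
not configurations). The last two conditions are the Euler-Lagrange equations of
`½ μ₁ ‖x₁'‖² + ½ μ₂ ‖x₂'‖² - V (q)` on the product of two spheres: along every tangent vector `v`
of the sphere at `x_j`, mass times acceleration equals minus the derivative of the potential
energy with respect to the position of the `j`-th particle. -/
structure IsMotion (μ₁ μ₂ : ℝ) (V : ℝ → ℝ) (x₁ x₂ : ℝ → E3) : Prop where
  contDiff₁ : ContDiff ℝ 2 x₁
  contDiff₂ : ContDiff ℝ 2 x₂
  sphere₁ : ∀ t, ‖x₁ t‖ = 1
  sphere₂ : ∀ t, ‖x₂ t‖ = 1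
  dist_mem : ∀ t, geoDist (x₁ t) (x₂ t) ∈ Ioo 0 π
  eq₁ : ∀ t, ∀ v : E3, inner ℝ (x₁ t) v = 0 →
    μ₁ * inner ℝ (deriv (deriv x₁) t) v =
      - fderiv ℝ (fun y : E3 => V (geoDist y (x₂ t))) (x₁ t) v
  eq₂ : ∀ t, ∀ v : E3, inner ℝ (x₂ t) v = 0 →
    μ₂ * inner ℝ (deriv (deriv x₂) t) v =
      - fderiv ℝ (fun y : E3 => V (geoDist (x₁ t) y)) (x₂ t) v

/-- The curve `(x₁, x₂)` is an orbit of the one-parameter group of rotations with constant angular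
velocity vector `ω` (axis `ℝ ω`, speed `‖ω‖`). -/
def RotatesWith (ω : E3) (x₁ x₂ : ℝ → E3) : Prop :=
  ∀ t : ℝ, x₁ t = NormedSpace.exp (t • rotGen ω) (x₁ 0) ∧
    x₂ t = NormedSpace.exp (t • rotGen ω) (x₂ 0)

/-- A relative equilibrium: a motion which is an orbit of a one-parameter subgroup of `SO(3)`. -/
def IsRE (μ₁ μ₂ : ℝ) (V : ℝ → ℝ) (x₁ x₂ : ℝ → E3) : Prop :=
  IsMotion μ₁ μ₂ V x₁ x₂ ∧ ∃ ω : E3, RotatesWith ω x₁ x₂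

/-- Two motions agree up to a rotation of the sphere and up to reversal of time. -/
def SameUpToSymmetry (x₁ x₂ y₁ y₂ : ℝ → E3) : Prop :=
  ∃ (R : E3 ≃ₗᵢ[ℝ] E3) (s : ℝ), LinearMap.det (R.toLinearEquiv : E3 →ₗ[ℝ] E3) = 1 ∧
    (s = 1 ∨ s = -1) ∧ ∀ t, y₁ t = R (x₁ (s * t)) ∧ y₂ t = R (x₂ (s * t))

/-- The angle in `[0, π/2]` between the line `ℝ ω` and the vector `x`. -/
def axisAngle (ω x : E3) : ℝ :=
  min (InnerProductGeometry.angle ω x) (InnerProductGeometry.angle (-ω) x)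

/-! The reduced system on `T*(0, π) × 𝔰𝔬(3)*`, in the coordinates `(q, p, m₁, m₂, m₃)`: `q` is the
distance, `p` its conjugate momentum, and `m` is the angular momentum in the moving orthonormal
frame `e₁ = e₂ × e₃`, `e₂ = (x₂ - cos q x₁) / sin q`, `e₃ = -x₁`. -/

/-- The inverse of the mass matrix
`(μ₂, μ₂, 0, 0; μ₂, μ₁+μ₂, 0, 0; 0, 0, μ₁+μ₂C², μ₂SC; 0, 0, μ₂SC, μ₂S²)`, where `S = sin q` and
`C = cos q`, of the kinetic energy in the variables `(q', ω₁, ω₂, ω₃)`. -/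
def invMassMatrix (μ₁ μ₂ q : ℝ) : Matrix (Fin 4) (Fin 4) ℝ :=
  (1 / (μ₁ * μ₂)) •
    !![μ₁ + μ₂, -μ₂, 0, 0;
       -μ₂, μ₂, 0, 0;
       0, 0, μ₂, -(μ₂ * cos q / sin q);
       0, 0, -(μ₂ * cos q / sin q), (μ₁ + μ₂ * cos q ^ 2) / sin q ^ 2]

/-- The reduced Hamiltonian, a function of `z = (q, p, m₁, m₂, m₃)`. -/
def hamiltonian (μ₁ μ₂ : ℝ) (V : ℝ → ℝ) (z : Fin 5 → ℝ) : ℝ :=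
  (1 / 2) * (![z 1, z 2, z 3, z 4] ⬝ᵥ
    (invMassMatrix μ₁ μ₂ (z 0)).mulVec ![z 1, z 2, z 3, z 4]) + V (z 0)

/-- The partial derivative of `f` with respect to the `i`-th coordinate. -/
def pderiv (f : (Fin 5 → ℝ) → ℝ) (i : Fin 5) (z : Fin 5 → ℝ) : ℝ :=
  fderiv ℝ f z (Pi.single i 1)

/-- The reduced equations of motion: `q' = H_p`, `p' = -H_q`, `m' = m × H_m`. -/
def reducedField (μ₁ μ₂ : ℝ) (V : ℝ → ℝ) (z : Fin 5 → ℝ) : Fin 5 → ℝ :=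
  let H := hamiltonian μ₁ μ₂ V
  ![pderiv H 1 z,
    -pderiv H 0 z,
    z 3 * pderiv H 4 z - z 4 * pderiv H 3 z,
    z 4 * pderiv H 2 z - z 2 * pderiv H 4 z,
    z 2 * pderiv H 3 z - z 3 * pderiv H 2 z]

/-- The point `(q, p, m₁, m₂, m₃)` of the reduced space which represents the state at time `t` of
the curve `(x₁, x₂)`. Here `J` is the angular momentum, `p = ∂L/∂q'` and `m_j = J ⬝ e_j`. -/
def reducedState (μ₁ μ₂ : ℝ) (x₁ x₂ : ℝ → E3) (t : ℝ) : Fin 5 → ℝ :=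
  let q := geoDist (x₁ t) (x₂ t)
  let J := μ₁ • cross (x₁ t) (deriv x₁ t) + μ₂ • cross (x₂ t) (deriv x₂ t)
  let e₂ := (1 / sin q) • (x₂ t - cos q • x₁ t)
  let e₃ := -x₁ t
  ![q,
    μ₂ * inner ℝ (deriv x₂ t) (cos q • e₂ + sin q • e₃),
    inner ℝ J (cross e₂ e₃),
    inner ℝ J e₂,
    inner ℝ J e₃]

/-- The (complexified) matrix of the linearization of the reduced equations at `z`. -/
def linearization (μ₁ μ₂ : ℝ) (V : ℝ → ℝ) (z : Fin 5 → ℝ) : Matrix (Fin 5) (Fin 5) ℂ :=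
  (LinearMap.toMatrix' (fderiv ℝ (reducedField μ₁ μ₂ V) z : (Fin 5 → ℝ) →ₗ[ℝ] (Fin 5 → ℝ))).map
    (fun a : ℝ => (a : ℂ))

/-- The relative equilibrium `(x₁, x₂)` is elliptic: the linearization of the reduced equations at
the corresponding equilibrium is semisimple with all its eigenvalues on the imaginary axis, and
`0` is a simple eigenvalue. (This one zero is due to the Casimir function `m₁² + m₂² + m₃²`; the
four eigenvalues along the symplectic leaf are purely imaginary and nonzero.) The reduced state is
constant along a relative equilibrium, so it may be taken at time `0`. -/
def IsElliptic (μ₁ μ₂ : ℝ) (V : ℝ → ℝ) (x₁ x₂ : ℝ → E3) : Prop :=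
  let L := linearization μ₁ μ₂ V (reducedState μ₁ μ₂ x₁ x₂ 0)
  (∀ z : ℂ, Module.End.HasEigenvalue (Matrix.toLin' L) z → z.re = 0) ∧
    Module.End.IsSemisimple (Matrix.toLin' L) ∧
    L.charpoly.rootMultiplicity 0 = 1

/-- The relative equilibrium `(x₁, x₂)` is linearly unstable: the linearization of the reduced
equations at the corresponding equilibrium has an eigenvalue with positive real part. -/
def IsLinearlyUnstable (μ₁ μ₂ : ℝ) (V : ℝ → ℝ) (x₁ x₂ : ℝ → E3) : Prop :=
  ∃ z : ℂ, Module.End.HasEigenvalue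
    (Matrix.toLin' (linearization μ₁ μ₂ V (reducedState μ₁ μ₂ x₁ x₂ 0))) z ∧ 0 < z.re

/-- The equation for the angle `α` between the axis of rotation and the smaller mass at the loss of
stability, for the ratio `μ < 1` of the smaller to the larger mass. -/
def IsCriticalAlpha (μ α : ℝ) : Prop :=
  α ∈ Ioo (π / 2) π ∧
    cos (2 * α) = 2 * sin α ^ 2 * √(1 - μ ^ 2 * sin (2 * α) ^ 2)

end TwoBody

end

namespace TwoBody

/-! Under a rotation with angular velocity `ω` the acceleration of a particle at `x` has tangential
part `⟨ω, x⟩ ω`, while the force on it is directed along the other particle `y`. Hence `ω = a x₁ + b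
x₂`, and the equations of motion become two scalar equations in `a, b` (`Balanced`). Their
difference is a homogeneous quadratic for `a : b` whose roots have product `-μ₁/μ₂`. Repulsion
forces `a b < 0`, which selects the negative root. The strength of the force then fixes `(a, b)` up
to a common sign, and that sign is the direction of time. At a right angle the quadratic degenerates
to `(μ₂ - μ₁) a b = 0`. Since `‖ω‖ cos θ₁ = |a + b cos q|` and `‖ω‖ sin θ₁ = |b| sin q`, the force
equations turn into the relations between `sin 2θ_j` and `‖ω‖`.

For `V = cot` the reduced system is reversible under `(p, m₁) ↦ (-p, -m₁)`, and the equilibria have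
`p = m₁ = 0`. The linearization therefore exchanges two coordinate subspaces, and its characteristic
polynomial is `X` times a quadratic in `X²`. With `w = ‖ω‖` and `x = 2 sin θ₁ sin θ₂` this quadratic
is `(X² + w²(1 - x))(X² + w²(1 + x))` (`charpoly_cotMatrix`, `IsRE.exists_charpoly`), so stability
is decided by comparing `x` with `1`. As `x = cos (θ₁ - θ₂) + cos q`, obtuse equilibria have `x <
1`. On the acute branch `x` strictly decreases in `q` (`AcuteAngles.two_sin_lt`), and the equation
for `α†` expresses `x = 1` (`IsCriticalAlpha.two_sin_eq_one`). -/

/-! ### Vector algebra in `ℝ³`. -/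

theorem inner_eq_sum (u v : E3) : inner ℝ u v = u 0 * v 0 + u 1 * v 1 + u 2 * v 2 := by
  simp [PiLp.inner_apply, Fin.sum_univ_three, mul_comm]

theorem cross_apply_zero (u v : E3) : cross u v 0 = u 1 * v 2 - u 2 * v 1 := by
  simp [cross, crossProduct]

theorem cross_apply_one (u v : E3) : cross u v 1 = u 2 * v 0 - u 0 * v 2 := by
  simp [cross, crossProduct]

theorem cross_apply_two (u v : E3) : cross u v 2 = u 0 * v 1 - u 1 * v 0 := by
  simp [cross, crossProduct]

theorem ext_coords {u v : E3} (h0 : u 0 = v 0) (h1 : u 1 = v 1) (h2 : u 2 = v 2) : u = v := by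
  ext i
  fin_cases i
  exacts [h0, h1, h2]

theorem rotGen_apply (ω x : E3) : rotGen ω x = cross ω x := rfl

theorem cross_cross_right (u v w : E3) :
    cross u (cross v w) = (inner ℝ u w) • v - (inner ℝ u v) • w := by
  apply ext_coords <;>
  simp [inner_eq_sum, cross_apply_zero, cross_apply_one, cross_apply_two] <;> ring

theorem inner_cross_self_left (u v : E3) : inner ℝ (cross u v) u = 0 := by
  simp [inner_eq_sum, cross_apply_zero, cross_apply_one, cross_apply_two]; ring

theorem inner_cross_self_right (u v : E3) : inner ℝ (cross u v) v = 0 := by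
  simp [inner_eq_sum, cross_apply_zero, cross_apply_one, cross_apply_two]; ring

theorem inner_cross_cross (u v w x : E3) : inner ℝ (cross u v) (cross w x) =
    inner ℝ u w * inner ℝ v x - inner ℝ u x * inner ℝ v w := by
  simp [inner_eq_sum, cross_apply_zero, cross_apply_one, cross_apply_two]; ring

theorem inner_cross_left_swap (ω x y : E3) :
    inner ℝ (cross ω x) y + inner ℝ x (cross ω y) = 0 := by
  simp [inner_eq_sum, cross_apply_zero, cross_apply_one, cross_apply_two]; ring

/-! ### One-parameter groups of rotations. -/

/-- The rotation by the angle `t ‖ω‖` about `ω`. -/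
noncomputable abbrev rot (ω : E3) (t : ℝ) : E3 →L[ℝ] E3 := NormedSpace.exp (t • rotGen ω)

theorem hasDerivAt_rot (ω x : E3) (t : ℝ) :
    HasDerivAt (fun t => rot ω t x) (cross ω (rot ω t x)) t := by
  have h := hasDerivAt_exp_smul_const' (𝕂 := ℝ) (rotGen ω) t
  exact h.clm_apply (hasDerivAt_const t x) |>.congr_deriv (by simp [rotGen_apply])

theorem rot_zero (ω : E3) : rot ω 0 = 1 := by
  have h : (0 : ℝ) • rotGen ω = 0 := by ext1; simp
  rw [rot, h, NormedSpace.exp_zero]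

theorem deriv_rot (ω x : E3) : deriv (fun t => rot ω t x) = fun t => rotGen ω (rot ω t x) :=
  funext fun t => (hasDerivAt_rot ω x t).deriv

theorem deriv_deriv_rot (ω x : E3) (t : ℝ) :
    deriv (deriv fun t => rot ω t x) t = cross ω (cross ω (rot ω t x)) := by
  rw [deriv_rot]
  exact ((rotGen ω).hasFDerivAt.comp_hasDerivAt t (hasDerivAt_rot ω x t)).deriv

/-- The derivative of the curve is a continuous linear image of the curve, so smoothness bootstraps.
-/
theorem contDiff_rot (ω x : E3) : ContDiff ℝ 2 (fun t => rot ω t x) := by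
  have h1 : ∀ n : ℕ, ContDiff ℝ n (fun t => rot ω t x) := by
    intro n
    induction n with
    | zero =>
      exact contDiff_zero.2
        (continuous_iff_continuousAt.2 fun t => (hasDerivAt_rot ω x t).continuousAt)
    | succ n ih =>
      rw [Nat.cast_succ, contDiff_succ_iff_deriv]
      refine ⟨fun t => (hasDerivAt_rot ω x t).differentiableAt, by simp, ?_⟩
      rw [deriv_rot]
      exact (rotGen ω).contDiff.comp ih
  exact_mod_cast h1 2

theorem inner_rot_rot (ω x y : E3) (t : ℝ) : inner ℝ (rot ω t x) (rot ω t y) = inner ℝ x y := by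
  have hd : ∀ t, HasDerivAt (fun t => inner ℝ (rot ω t x) (rot ω t y)) 0 t := fun t =>
    ((hasDerivAt_rot ω x t).inner ℝ (hasDerivAt_rot ω y t)).congr_deriv (by
      have := inner_cross_left_swap ω (rot ω t x) (rot ω t y)
      linarith)
  have := is_const_of_deriv_eq_zero (fun t => (hd t).differentiableAt) (fun t => (hd t).deriv) t 0
  simpa [rot_zero] using this

theorem norm_rot (ω x : E3) (t : ℝ) : ‖rot ω t x‖ = ‖x‖ := by
  rw [norm_eq_sqrt_real_inner, norm_eq_sqrt_real_inner, inner_rot_rot]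

/-- The inner product with `ω` and the norm are both conserved, which makes `‖rot ω t ω - ω‖²`
vanish. -/
theorem rot_self (ω : E3) (t : ℝ) : rot ω t ω = ω := by
  have h0 : ∀ t, ‖rot ω t ω - ω‖ = 0 := by
    have hd : ∀ t, HasDerivAt (fun t => inner ℝ (rot ω t ω) ω) 0 t := fun t =>
      ((hasDerivAt_rot ω ω t).inner ℝ (hasDerivAt_const t ω)).congr_deriv (by
        simp [inner_cross_self_left])
    intro t
    have h1 := is_const_of_deriv_eq_zero (fun t => (hd t).differentiableAt)
      (fun t => (hd t).deriv) t 0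
    simp only [rot_zero, one_apply_eq_self] at h1
    have h2 := norm_sub_sq_real (rot ω t ω) ω
    rw [h1, norm_rot, real_inner_self_eq_norm_sq] at h2
    have : ‖rot ω t ω - ω‖ ^ 2 = 0 := by rw [h2]; ring
    exact pow_eq_zero_iff (two_ne_zero) |>.1 this
  exact sub_eq_zero.1 (norm_eq_zero.1 (h0 t))

/-- Intertwining the generators intertwines the one-parameter groups. -/
theorem rot_intertwine {ω ω' : E3} (R : E3 →L[ℝ] E3) (s : ℝ)
    (h : ∀ x, R (s • cross ω x) = cross ω' (R x)) (t : ℝ) (x : E3) :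
    R (rot ω (s * t) x) = rot ω' t (R x) := by
  have h1 : SemiconjBy R ((s * t) • rotGen ω) (t • rotGen ω') := by
    ext1 x
    simp [mul_comm s t, mul_smul, rotGen_apply, ← h]
  let _ : NormedAlgebra ℚ (E3 →L[ℝ] E3) := NormedAlgebra.restrictScalars ℚ ℝ _
  exact congrArg (fun f : E3 →L[ℝ] E3 => f x) h1.exp_right.eq

/-! ### Forces and their balance. -/

theorem cos_geoDist {x y : E3} (hx : ‖x‖ = 1) (hy : ‖y‖ = 1) : cos (geoDist x y) = inner ℝ x y := by
  have h := abs_le.1 (abs_real_inner_le_norm x y)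
  rw [hx, hy, mul_one] at h
  exact cos_arccos h.1 h.2

theorem geoDist_comm (x y : E3) : geoDist x y = geoDist y x := by
  rw [geoDist, geoDist, real_inner_comm]

theorem inner_mem_Ioo_of_geoDist {x y : E3} (h : geoDist x y ∈ Ioo 0 π) :
    inner ℝ x y ∈ Ioo (-1 : ℝ) 1 := by
  refine ⟨?_, arccos_pos.1 h.1⟩
  by_contra hc
  exact h.2.ne (arccos_of_le_neg_one (not_lt.1 hc))

/-- The potential depends on `z` only through `⟨y, z⟩`, so its gradient in `ℝ³` is a multiple of
`y`. -/
theorem fderiv_potential {V : ℝ → ℝ} {x y : E3} (h : geoDist x y ∈ Ioo 0 π)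
    (hV : DifferentiableAt ℝ V (geoDist x y)) (v : E3) :
    fderiv ℝ (fun z : E3 => V (geoDist z y)) x v =
      -(deriv V (geoDist x y) / sin (geoDist x y)) * inner ℝ y v := by
  obtain ⟨h1, h2⟩ := inner_mem_Ioo_of_geoDist h
  have h3 : HasFDerivAt (fun z : E3 => inner ℝ y z) (innerSL ℝ y) x := (innerSL ℝ y).hasFDerivAt
  have h4 : HasDerivAt arccos (-(1 / √(1 - (inner ℝ y x) ^ 2))) (inner ℝ y x) := by
    rw [real_inner_comm]; exact hasDerivAt_arccos h1.ne' h2.ne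
  have h5 : HasDerivAt V (deriv V (geoDist x y)) (arccos (inner ℝ y x)) := by
    rw [real_inner_comm]; exact hV.hasDerivAt
  have h6 := (h5.comp _ h4).comp_hasFDerivAt x h3
  have h7 : (fun z : E3 => V (geoDist z y)) = (V ∘ arccos) ∘ fun z : E3 => inner ℝ y z := by
    funext z; simp [geoDist, real_inner_comm]
  rw [h7, h6.fderiv]
  have h8 : sin (geoDist x y) = √(1 - (inner ℝ y x) ^ 2) := by
    rw [geoDist, sin_arccos, real_inner_comm]
  rw [h8, _root_.smul_apply, innerSL_apply_apply, smul_eq_mul]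
  ring

theorem fderiv_potential_right {V : ℝ → ℝ} {x y : E3} (h : geoDist x y ∈ Ioo 0 π)
    (hV : DifferentiableAt ℝ V (geoDist x y)) (v : E3) :
    fderiv ℝ (fun z : E3 => V (geoDist x z)) y v =
      -(deriv V (geoDist x y) / sin (geoDist x y)) * inner ℝ x v := by
  rw [geoDist_comm] at h hV ⊢
  simp only [geoDist_comm x]
  exact fderiv_potential h hV v

/-- The balance of forces for two unit vectors at distance `q`, rotating with angular velocity
`a • x + b • y`, where `V' (q) = F`. -/
structure Balanced (μ₁ μ₂ q F a b : ℝ) : Prop where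
  eq₁ : μ₁ * (a + b * cos q) * b * sin q = F
  eq₂ : μ₂ * (b + a * cos q) * a * sin q = F

/-- The remaining term `-‖ω‖² x` of the acceleration is normal to the sphere. -/
theorem inner_centripetal (ω x v : E3) (h : inner ℝ x v = 0) :
    inner ℝ (cross ω (cross ω x)) v = inner ℝ ω x * inner ℝ ω v := by
  rw [cross_cross_right, inner_sub_left, real_inner_smul_left, real_inner_smul_left, h]
  ring

/-- The force equation at one particle says that the angular velocity lies in the plane of the two
particles. -/
theorem exists_smul_add_of_forceEq {ω x y : E3} {μ f c : ℝ} (hμ : μ ≠ 0) (hf : f ≠ 0)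
    (hx : ‖x‖ = 1) (hy : ‖y‖ = 1) (hc : inner ℝ x y = c) (hc1 : c ^ 2 ≠ 1)
    (h : ∀ v : E3, inner ℝ x v = 0 → μ * (inner ℝ ω x * inner ℝ ω v) = f * inner ℝ y v) :
    ∃ a b : ℝ, ω = a • x + b • y := by
  have hxx : inner ℝ x x = 1 := by rw [real_inner_self_eq_norm_sq, hx, one_pow]
  have hyy : inner ℝ y y = 1 := by rw [real_inner_self_eq_norm_sq, hy, one_pow]
  -- If `ω ⟂ x`, testing with the tangential part of `y` would show that the force vanishes.
  have hne : inner ℝ ω x ≠ 0 := by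
    intro h0
    have := h (y - c • x) (by simp [inner_sub_right, real_inner_smul_right, hc, hx])
    rw [h0, zero_mul, mul_zero, inner_sub_right (𝕜 := ℝ) y, real_inner_smul_right, hyy,
      real_inner_comm, hc] at this
    rcases mul_eq_zero.1 this.symm with h1 | h1
    · exact hf h1
    · exact hc1 (by linarith)
  -- By the force equation `g` is orthogonal to the tangent plane at `x`, hence parallel to `x`;
  -- solving for `ω` gives the coefficients.
  set g : E3 := (μ * inner ℝ ω x) • ω - f • y with hg
  set v : E3 := g - (inner ℝ x g) • x with hv
  have hxv : inner ℝ x v = 0 := by simp [hv, inner_sub_right, real_inner_smul_right, hx]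
  have hgv : inner ℝ g v = 0 := by
    rw [hg, inner_sub_left, real_inner_smul_left, real_inner_smul_left]
    linarith [h v hxv]
  have hv0 : v = 0 := by
    rw [← inner_self_eq_zero (𝕜 := ℝ)]
    nth_rewrite 1 [hv]
    rw [inner_sub_left, real_inner_smul_left, hxv, hgv]
    ring
  have hg' : g = (inner ℝ x g) • x := sub_eq_zero.1 hv0
  have hm : μ * inner ℝ ω x ≠ 0 := mul_ne_zero hμ hne
  refine ⟨(μ * inner ℝ ω x)⁻¹ * inner ℝ x g, (μ * inner ℝ ω x)⁻¹ * f, ?_⟩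
  rw [mul_smul, mul_smul, ← smul_add, ← hg', hg, sub_add_cancel, smul_smul, inv_mul_cancel₀ hm,
    one_smul]

theorem exists_balanced {μ₁ μ₂ : ℝ} (hμ₁ : 0 < μ₁) {V : ℝ → ℝ} {x₁ x₂ : ℝ → E3} {ω : E3}
    (hm : IsMotion μ₁ μ₂ V x₁ x₂) (hr : RotatesWith ω x₁ x₂)
    (hV : DifferentiableAt ℝ V (geoDist (x₁ 0) (x₂ 0)))
    (hF : deriv V (geoDist (x₁ 0) (x₂ 0)) ≠ 0) :
    ∃ a b : ℝ, ω = a • x₁ 0 + b • x₂ 0 ∧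
      Balanced μ₁ μ₂ (geoDist (x₁ 0) (x₂ 0)) (deriv V (geoDist (x₁ 0) (x₂ 0))) a b := by
  have e1 : x₁ = fun t => rot ω t (x₁ 0) := funext fun t => (hr t).1
  have e2 : x₂ = fun t => rot ω t (x₂ 0) := funext fun t => (hr t).2
  have h1 := hm.eq₁ 0
  have h2 := hm.eq₂ 0
  have hx := hm.sphere₁ 0
  have hy := hm.sphere₂ 0
  have hq := hm.dist_mem 0
  have d1 : deriv (deriv x₁) 0 = cross ω (cross ω (x₁ 0)) := by
    rw [e1, deriv_deriv_rot]
  have d2 : deriv (deriv x₂) 0 = cross ω (cross ω (x₂ 0)) := by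
    rw [e2, deriv_deriv_rot]
  have hs : 0 < sin (geoDist (x₁ 0) (x₂ 0)) := sin_pos_of_mem_Ioo hq
  have hc := (cos_geoDist hx hy).symm
  have hsc := sin_sq_add_cos_sq (geoDist (x₁ 0) (x₂ 0))
  simp only [d1, fderiv_potential hq hV] at h1
  simp only [d2, fderiv_potential_right hq hV] at h2
  generalize geoDist (x₁ 0) (x₂ 0) = q at *
  generalize x₁ 0 = x at *
  generalize x₂ 0 = y at *
  generalize deriv V q = F at *
  have hxx : inner ℝ x x = 1 := by rw [real_inner_self_eq_norm_sq, hx, one_pow]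
  have hyy : inner ℝ y y = 1 := by rw [real_inner_self_eq_norm_sq, hy, one_pow]
  have hc' : inner ℝ y x = cos q := by rw [real_inner_comm, hc]
  obtain ⟨a, b, hab⟩ := exists_smul_add_of_forceEq (ω := ω) hμ₁.ne' (div_ne_zero hF hs.ne') hx hy hc
    (by nlinarith) (fun v hv => by rw [← inner_centripetal _ _ _ hv, h1 v hv]; ring)
  refine ⟨a, b, hab, ?_, ?_⟩
  -- The tangent direction in the plane of the particles carries the whole equation; its squared
  -- length `sin² q` is cancelled below.
  · have h3 := h1 (y - cos q • x) (by simp [inner_sub_right, real_inner_smul_right, hc, hx])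
    rw [inner_centripetal _ _ _ (by simp [inner_sub_right, real_inner_smul_right, hc, hx]), hab]
      at h3
    simp only [inner_add_left, inner_sub_right, real_inner_smul_left, real_inner_smul_right, hxx,
      hyy, hc, hc'] at h3
    field_simp at h3
    have h4 : 1 - cos q ^ 2 = sin q ^ 2 := by linarith
    have h5 : sin q ^ 2 * (μ₁ * (a + b * cos q) * b * sin q) = sin q ^ 2 * F := by
      rw [← h4]; linear_combination h3
    exact mul_left_cancel₀ (pow_ne_zero 2 hs.ne') h5
  · have h3 := h2 (x - cos q • y) (by simp [inner_sub_right, real_inner_smul_right, hc', hy])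
    rw [inner_centripetal _ _ _ (by simp [inner_sub_right, real_inner_smul_right, hc', hy]), hab]
      at h3
    simp only [inner_add_left, inner_sub_right, real_inner_smul_left, real_inner_smul_right, hxx,
      hyy, hc, hc'] at h3
    field_simp at h3
    have h4 : 1 - cos q ^ 2 = sin q ^ 2 := by linarith
    have h5 : sin q ^ 2 * (μ₂ * (b + a * cos q) * a * sin q) = sin q ^ 2 * F := by
      rw [← h4]; linear_combination h3
    exact mul_left_cancel₀ (pow_ne_zero 2 hs.ne') h5

theorem isMotion_of_balanced {μ₁ μ₂ : ℝ} {V : ℝ → ℝ} {x y : E3} {a b : ℝ}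
    (hx : ‖x‖ = 1) (hy : ‖y‖ = 1) (hq : geoDist x y ∈ Ioo 0 π)
    (hV : DifferentiableAt ℝ V (geoDist x y))
    (hB : Balanced μ₁ μ₂ (geoDist x y) (deriv V (geoDist x y)) a b) :
    IsMotion μ₁ μ₂ V (fun t => rot (a • x + b • y) t x) (fun t => rot (a • x + b • y) t y) := by
  have hxx : inner ℝ x x = 1 := by rw [real_inner_self_eq_norm_sq, hx, one_pow]
  have hyy : inner ℝ y y = 1 := by rw [real_inner_self_eq_norm_sq, hy, one_pow]
  have hc := (cos_geoDist hx hy).symm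
  have hc' : inner ℝ y x = cos (geoDist x y) := by rw [real_inner_comm, hc]
  have hg : ∀ t, geoDist (rot (a • x + b • y) t x) (rot (a • x + b • y) t y) = geoDist x y :=
    fun t => by rw [geoDist, inner_rot_rot, geoDist]
  have hs : 0 < sin (geoDist x y) := sin_pos_of_mem_Ioo hq
  -- The rotation fixes its axis, so the coefficients of `ω` along the moving particles stay `a, b`,
  -- and the equations at time `t` are those at time `0`.
  have hω : ∀ t, a • x + b • y =
      a • rot (a • x + b • y) t x + b • rot (a • x + b • y) t y := fun t => by
    rw [← map_smul, ← map_smul, ← map_add, rot_self]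
  have hin : ∀ t z, inner ℝ (a • x + b • y) (rot (a • x + b • y) t z) =
      inner ℝ (a • x + b • y) z := fun t z => by
    have h := inner_rot_rot (a • x + b • y) (a • x + b • y) z t
    rwa [rot_self] at h
  refine ⟨contDiff_rot _ _, contDiff_rot _ _, fun t => by rw [norm_rot, hx],
    fun t => by rw [norm_rot, hy], fun t => by rw [hg]; exact hq, ?_, ?_⟩
  · intro t v hv
    rw [deriv_deriv_rot, inner_centripetal _ _ _ hv,
      fderiv_potential (by rw [hg]; exact hq) (by rw [hg]; exact hV), hg, hin]
    have h1 : inner ℝ (a • x + b • y) v = b * inner ℝ (rot (a • x + b • y) t y) v := by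
      conv_lhs => rw [hω t]
      rw [inner_add_left, real_inner_smul_left, real_inner_smul_left, hv]
      ring
    rw [h1, ← hB.eq₁]
    simp only [inner_add_left, real_inner_smul_left, hxx, hc']
    field_simp
  · intro t v hv
    rw [deriv_deriv_rot, inner_centripetal _ _ _ hv,
      fderiv_potential_right (by rw [hg]; exact hq) (by rw [hg]; exact hV), hg, hin]
    have h1 : inner ℝ (a • x + b • y) v = a * inner ℝ (rot (a • x + b • y) t x) v := by
      conv_lhs => rw [hω t]
      rw [inner_add_left, real_inner_smul_left, real_inner_smul_left, hv]
      ring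
    rw [h1, ← hB.eq₂]
    simp only [inner_add_left, real_inner_smul_left, hyy, hc]
    field_simp
    ring

/-! ### Algebra of the balance equations. -/

namespace Balanced

variable {μ₁ μ₂ q F a b : ℝ}

theorem mul_lt_zero₁ (h : Balanced μ₁ μ₂ q F a b) (hμ₁ : 0 < μ₁) (hq : q ∈ Ioo 0 π) (hF : F < 0) :
    b * (a + b * cos q) < 0 := by
  have hs : 0 < sin q := sin_pos_of_mem_Ioo hq
  have h1 := h.eq₁
  by_contra hc
  have h2 : 0 ≤ (b * (a + b * cos q)) * (μ₁ * sin q) :=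
    mul_nonneg (not_lt.1 hc) (mul_pos hμ₁ hs).le
  linarith

theorem mul_lt_zero₂ (h : Balanced μ₁ μ₂ q F a b) (hμ₂ : 0 < μ₂) (hq : q ∈ Ioo 0 π) (hF : F < 0) :
    a * (b + a * cos q) < 0 := by
  have hs : 0 < sin q := sin_pos_of_mem_Ioo hq
  have h1 := h.eq₂
  by_contra hc
  have h2 : 0 ≤ (a * (b + a * cos q)) * (μ₂ * sin q) :=
    mul_nonneg (not_lt.1 hc) (mul_pos hμ₂ hs).le
  linarith

/-- If `a b ≥ 0`, the two sign conditions read `a b < -b² cos q` and `a b < -a² cos q`; their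
product gives `a² b² sin² q ≤ 0`. -/
theorem coeff_mul_neg (h : Balanced μ₁ μ₂ q F a b) (hμ₁ : 0 < μ₁) (hμ₂ : 0 < μ₂)
    (hq : q ∈ Ioo 0 π) (hF : F < 0) : a * b < 0 := by
  have h1 := h.mul_lt_zero₁ hμ₁ hq hF
  have h2 := h.mul_lt_zero₂ hμ₂ hq hF
  have hs : 0 < sin q := sin_pos_of_mem_Ioo hq
  have hsc := sin_sq_add_cos_sq q
  by_contra hc
  have hab := not_lt.1 hc
  have h3 : 0 < b ^ 2 * (-cos q) - a * b := by linarith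
  have h4 : 0 < a ^ 2 * (-cos q) - a * b := by linarith
  have h5 : 0 < -cos q := by
    by_contra h6
    nlinarith [sq_nonneg b]
  have h7 : (a * b) ^ 2 ≤ (b ^ 2 * (-cos q)) * (a ^ 2 * (-cos q)) := by
    rw [sq]; exact mul_le_mul (by linarith) (by linarith) hab (by positivity)
  have h8 : 0 < (a ^ 2 * b ^ 2) * sin q ^ 2 := by
    have : a ≠ 0 := by rintro rfl; simp at h2
    have : b ≠ 0 := by rintro rfl; simp at h1
    positivity
  nlinarith

theorem hemispheres (h : Balanced μ₁ μ₂ q F a b) (hμ₁ : 0 < μ₁) (hμ₂ : 0 < μ₂)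
    (hq : q ∈ Ioo 0 π) (hF : F < 0) : (a + b * cos q) * (b + a * cos q) < 0 := by
  have h1 := h.mul_lt_zero₁ hμ₁ hq hF
  have h2 := h.mul_lt_zero₂ hμ₂ hq hF
  have h3 := h.coeff_mul_neg hμ₁ hμ₂ hq hF
  have h4 := mul_pos_of_neg_of_neg h1 h2
  have h5 : a * b * ((a + b * cos q) * (b + a * cos q)) =
    b * (a + b * cos q) * (a * (b + a * cos q)) := by ring
  rw [← h5] at h4
  exact neg_of_mul_pos_right h4 h3.le

theorem cos_ne_zero (h : Balanced μ₁ μ₂ q F a b) (hne : μ₁ ≠ μ₂) (hF : F < 0) : cos q ≠ 0 := by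
  intro hc
  have h1 := h.eq₁
  have h2 := h.eq₂
  rw [hc] at h1 h2
  have h3 : (μ₁ - μ₂) * (a * b * sin q) = 0 := by linear_combination h1 - h2
  rcases mul_eq_zero.1 h3 with h4 | h4
  · exact hne (sub_eq_zero.1 h4)
  · have : μ₁ * (a * b * sin q) = F := by linear_combination h1
    rw [h4, mul_zero] at this
    exact hF.ne this.symm

/-- Eliminating `F` leaves an equation for the ratio `a : b` alone. -/
theorem quadratic (h : Balanced μ₁ μ₂ q F a b) (hq : q ∈ Ioo 0 π) :
    μ₂ * cos q * a ^ 2 + (μ₂ - μ₁) * (a * b) - μ₁ * cos q * b ^ 2 = 0 := by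
  have hs : 0 < sin q := sin_pos_of_mem_Ioo hq
  have h1 : sin q * (μ₂ * cos q * a ^ 2 + (μ₂ - μ₁) * (a * b) - μ₁ * cos q * b ^ 2) = 0 := by
    linear_combination h.eq₂ - h.eq₁
  exact (mul_eq_zero.1 h1).resolve_left hs.ne'

/-- The coefficients of the angular velocity are determined up to a common sign. -/
theorem unique {a' b' : ℝ} (h : Balanced μ₁ μ₂ q F a b) (h' : Balanced μ₁ μ₂ q F a' b')
    (hμ₁ : 0 < μ₁) (hμ₂ : 0 < μ₂) (hne : μ₁ ≠ μ₂) (hq : q ∈ Ioo 0 π) (hF : F < 0) :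
    (a' = a ∧ b' = b) ∨ (a' = -a ∧ b' = -b) := by
  have hs : 0 < sin q := sin_pos_of_mem_Ioo hq
  have hc := h.cos_ne_zero hne hF
  have h1 := h.quadratic hq
  have h1' := h'.quadratic hq
  have h2 := h.coeff_mul_neg hμ₁ hμ₂ hq hF
  have h2' := h'.coeff_mul_neg hμ₁ hμ₂ hq hF
  have hb : b ≠ 0 := by rintro rfl; simp at h2
  have hb' : b' ≠ 0 := by rintro rfl; simp at h2'
  -- Eliminating the mixed term between the two quadratics. The second factor cannot vanish, because
  -- the ratios `a : b` and `a' : b'` are both negative.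
  have h3 : (a * b' - a' * b) * (cos q * (μ₂ * (a * a') + μ₁ * (b * b'))) = 0 := by
    linear_combination (a' * b') * h1 - (a * b) * h1'
  have hr : a * b' = a' * b := by
    rcases mul_eq_zero.1 h3 with h4 | h4
    · linarith
    · exfalso
      have h5 := (mul_eq_zero.1 h4).resolve_left hc
      have h6 : μ₂ * (a * b * (a' * b')) + μ₁ * (b * b') ^ 2 = 0 := by
        linear_combination (b * b') * h5
      have h7 : 0 < a * b * (a' * b') := mul_pos_of_neg_of_neg h2 h2'
      have h8 : 0 < μ₂ * (a * b * (a' * b')) := mul_pos hμ₂ h7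
      have h9 : 0 ≤ μ₁ * (b * b') ^ 2 := by positivity
      linarith
  have h4 : F * (b' ^ 2 - b ^ 2) = 0 := by
    linear_combination (-b' ^ 2) * h.eq₁ + b ^ 2 * h'.eq₁ + μ₁ * b * b' * sin q * hr
  have h5 : (b' - b) * (b' + b) = 0 := by
    linear_combination (mul_eq_zero.1 h4).resolve_left hF.ne
  rcases mul_eq_zero.1 h5 with h6 | h6
  · have h7 : b' = b := by linarith
    exact Or.inl ⟨mul_right_cancel₀ hb (by rw [← hr, h7]), h7⟩
  · have h7 : b' = -b := by linarith
    exact Or.inr ⟨mul_right_cancel₀ hb (by rw [← hr, h7]; ring), h7⟩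

end Balanced

theorem exists_root_neg {μ₁ μ₂ c : ℝ} (hμ₁ : 0 < μ₁) (hμ₂ : 0 < μ₂) (hc : c ≠ 0) :
    ∃ r < 0, μ₂ * c * r ^ 2 + (μ₂ - μ₁) * r - μ₁ * c = 0 := by
  have hc2 : 0 < c ^ 2 := by positivity
  -- A square root of the discriminant with the sign of `c`; since `|d| > |μ₁ - μ₂|`, the root `(μ₁
  -- - μ₂ - d) / (2 μ₂ c)` is then negative.
  obtain ⟨d, hd, hdc⟩ : ∃ d, d ^ 2 = (μ₂ - μ₁) ^ 2 + 4 * μ₁ * μ₂ * c ^ 2 ∧ 0 < d * c := by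
    have h0 : 0 < (μ₂ - μ₁) ^ 2 + 4 * μ₁ * μ₂ * c ^ 2 := by positivity
    rcases lt_or_gt_of_ne hc with h | h
    · exact ⟨-√_, by rw [neg_sq, sq_sqrt h0.le], mul_pos_of_neg_of_neg (by simpa using h0) h⟩
    · exact ⟨√_, sq_sqrt h0.le, mul_pos (sqrt_pos.2 h0) h⟩
  refine ⟨(μ₁ - μ₂ - d) / (2 * μ₂ * c), ?_, ?_⟩
  · have h1 : (μ₁ - μ₂) * c < d * c := by
      refine lt_of_abs_lt (abs_lt_of_sq_lt_sq ?_ hdc.le)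
      have : 0 < 4 * μ₁ * μ₂ * c ^ 2 * c ^ 2 := by positivity
      nlinarith
    have h2 : (μ₁ - μ₂ - d) / (2 * μ₂ * c) = ((μ₁ - μ₂) * c - d * c) / (2 * μ₂ * c ^ 2) := by
      field_simp
    rw [h2]
    exact div_neg_of_neg_of_pos (by linarith) (by positivity)
  · field_simp
    linear_combination hd

theorem exists_balanced_coeff {μ₁ μ₂ q F : ℝ} (hμ₁ : 0 < μ₁) (hμ₂ : 0 < μ₂) (hq : q ∈ Ioo 0 π)
    (hF : F < 0) (hc : cos q ≠ 0) : ∃ a b, Balanced μ₁ μ₂ q F a b := by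
  have hs : 0 < sin q := sin_pos_of_mem_Ioo hq
  have hsc := sin_sq_add_cos_sq q
  obtain ⟨r, hr, h⟩ := exists_root_neg hμ₁ hμ₂ hc
  have h1 : μ₁ * (r + cos q) = μ₂ * r * (1 + r * cos q) := by linear_combination -h
  -- Otherwise `1 + r cos q ≤ 0` with `0 < -r ≤ cos q`, so `1 ≤ cos² q`. The sign makes the
  -- prescribed value of `b²` positive.
  have h2 : r + cos q < 0 := by
    by_contra h3
    have h4 : 0 ≤ μ₂ * r * (1 + r * cos q) := h1 ▸ mul_nonneg hμ₁.le (not_lt.1 h3)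
    have h5 : 1 + r * cos q ≤ 0 := by
      by_contra h6
      exact absurd h4 (not_le.2 (mul_neg_of_neg_of_pos (mul_neg_of_pos_of_neg hμ₂ hr)
        (not_le.1 h6)))
    nlinarith
  have hD : μ₁ * sin q * (r + cos q) < 0 := mul_neg_of_pos_of_neg (by positivity) h2
  have hb : √(F / (μ₁ * sin q * (r + cos q))) ^ 2 = F / (μ₁ * sin q * (r + cos q)) :=
    sq_sqrt (div_pos_of_neg_of_neg hF hD).le
  have hb' := (eq_div_iff hD.ne).1 hb
  refine ⟨r * √(F / (μ₁ * sin q * (r + cos q))), √(F / (μ₁ * sin q * (r + cos q))), ?_, ?_⟩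
  · linear_combination hb'
  · linear_combination hb' - √(F / (μ₁ * sin q * (r + cos q))) ^ 2 * sin q * h1

/-! ### Angles between the axis and the particles. -/

/-- The angles between the axis and the two particles, in terms of the angular speed `w` and the
components of the angular velocity along the particles. -/
structure AxisAngles (q a b w θ₁ θ₂ : ℝ) : Prop where
  speed_pos : 0 < w
  speed_sq : w ^ 2 = a ^ 2 + b ^ 2 + 2 * (a * b) * cos q
  mem₁ : θ₁ ∈ Icc 0 (π / 2)
  mem₂ : θ₂ ∈ Icc 0 (π / 2)
  cos₁ : w * cos θ₁ = |a + b * cos q|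
  cos₂ : w * cos θ₂ = |b + a * cos q|

namespace AxisAngles

variable {μ₁ μ₂ q F a b w θ₁ θ₂ : ℝ}

theorem swap (h : AxisAngles q a b w θ₁ θ₂) : AxisAngles q b a w θ₂ θ₁ :=
  ⟨h.speed_pos, by rw [h.speed_sq]; ring, h.mem₂, h.mem₁, h.cos₂, h.cos₁⟩

/-- Pythagoras: `w² = (a + b cos q)² + (b sin q)²`, the components of `ω` along and across the first
particle. -/
theorem sin₁ (h : AxisAngles q a b w θ₁ θ₂) (hq : q ∈ Ioo 0 π) : w * sin θ₁ = |b| * sin q := by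
  have hs : 0 < sin q := sin_pos_of_mem_Ioo hq
  have h0 : 0 ≤ sin θ₁ := sin_nonneg_of_nonneg_of_le_pi h.mem₁.1 (by linarith [h.mem₁.2, pi_pos])
  have h1 : (w * sin θ₁) ^ 2 = (|b| * sin q) ^ 2 := by
    have h2 : (w * cos θ₁) ^ 2 = (a + b * cos q) ^ 2 := by rw [h.cos₁, sq_abs]
    rw [mul_pow |b|, sq_abs]
    linear_combination h.speed_sq - h2 + w ^ 2 * sin_sq_add_cos_sq θ₁ - b ^ 2 * sin_sq_add_cos_sq q
  exact (pow_left_inj₀ (mul_nonneg h.speed_pos.le h0) (by positivity) two_ne_zero).1 h1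

theorem sin₂ (h : AxisAngles q a b w θ₁ θ₂) (hq : q ∈ Ioo 0 π) : w * sin θ₂ = |a| * sin q :=
  h.swap.sin₁ hq

theorem mem_Ioo₁ (h : AxisAngles q a b w θ₁ θ₂) (hq : q ∈ Ioo 0 π) (hb : b ≠ 0)
    (ha : a + b * cos q ≠ 0) : θ₁ ∈ Ioo 0 (π / 2) := by
  have hs : 0 < sin q := sin_pos_of_mem_Ioo hq
  constructor
  · refine h.mem₁.1.lt_of_ne ?_
    rintro rfl
    have := h.sin₁ hq
    rw [sin_zero, mul_zero] at this
    have : 0 < |b| * sin q := by positivity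
    linarith
  · refine h.mem₁.2.lt_of_ne ?_
    rintro rfl
    have := h.cos₁
    rw [cos_pi_div_two, mul_zero] at this
    exact ha (abs_eq_zero.1 this.symm)

/-- The force equation is `μ₁ (w sin θ₁)(w cos θ₁) = -F`; repulsion fixes the sign when the absolute
values are removed. -/
theorem speed_sq_mul_sin₁ (h : AxisAngles q a b w θ₁ θ₂) (hB : Balanced μ₁ μ₂ q F a b)
    (hμ₁ : 0 < μ₁) (hq : q ∈ Ioo 0 π) (hF : F < 0) :
    w ^ 2 * (1 / 2 * μ₁ * sin (2 * θ₁)) = -F := by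
  have h1 : |b| * |a + b * cos q| = -(b * (a + b * cos q)) := by
    rw [← abs_mul, abs_of_neg (hB.mul_lt_zero₁ hμ₁ hq hF)]
  rw [sin_two_mul]
  linear_combination μ₁ * (w * cos θ₁) * h.sin₁ hq + μ₁ * |b| * sin q * h.cos₁ +
    μ₁ * sin q * h1 - hB.eq₁

theorem speed_sq_mul_sin₂ (h : AxisAngles q a b w θ₁ θ₂) (hB : Balanced μ₁ μ₂ q F a b)
    (hμ₂ : 0 < μ₂) (hq : q ∈ Ioo 0 π) (hF : F < 0) :
    w ^ 2 * (1 / 2 * μ₂ * sin (2 * θ₂)) = -F :=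
  h.swap.speed_sq_mul_sin₁ ⟨hB.eq₂, hB.eq₁⟩ hμ₂ hq hF

/-- `a b` and `(a + b cos q)(b + a cos q)` are both negative, so the addition formula yields `cos
(θ₁ + θ₂) = -cos q`, and both arguments lie where `cos` is injective. -/
theorem dist_eq (h : AxisAngles q a b w θ₁ θ₂) (hB : Balanced μ₁ μ₂ q F a b)
    (hμ₁ : 0 < μ₁) (hμ₂ : 0 < μ₂) (hq : q ∈ Ioo 0 π) (hF : F < 0) : q = π - (θ₁ + θ₂) := by
  have h1 : |a + b * cos q| * |b + a * cos q| = -((a + b * cos q) * (b + a * cos q)) := by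
    rw [← abs_mul, abs_of_neg (hB.hemispheres hμ₁ hμ₂ hq hF)]
  have h2 : |a| * |b| = -(a * b) := by
    rw [← abs_mul, abs_of_neg (hB.coeff_mul_neg hμ₁ hμ₂ hq hF)]
  have h3 : w ^ 2 * cos (θ₁ + θ₂) = w ^ 2 * cos (π - q) := by
    rw [cos_add, cos_pi_sub, h.speed_sq]
    calc (a ^ 2 + b ^ 2 + 2 * (a * b) * cos q) * (cos θ₁ * cos θ₂ - sin θ₁ * sin θ₂)
        = (w * cos θ₁) * (w * cos θ₂) - (w * sin θ₁) * (w * sin θ₂) := by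
          rw [← h.speed_sq]; ring
      _ = _ := by
          rw [h.cos₁, h.cos₂, h.sin₁ hq, h.sin₂ hq]
          linear_combination h1 - sin q ^ 2 * h2 + a * b * sin_sq_add_cos_sq q
  have h4 := mul_left_cancel₀ (pow_ne_zero 2 h.speed_pos.ne') h3
  have h5 := injOn_cos ⟨add_nonneg h.mem₁.1 h.mem₂.1, by linarith [h.mem₁.2, h.mem₂.2]⟩
    ⟨by linarith [hq.2], by linarith [hq.1]⟩ h4
  linarith

end AxisAngles

/-- `sin 2x - sin 2y = 2 sin (x - y) cos (x + y)`, and the last factor is negative here. -/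
theorem lt_of_sin_two_mul_lt {x y : ℝ} (hx : x ∈ Ioo 0 (π / 2)) (hy : y ∈ Ioo 0 (π / 2))
    (hxy : π / 2 < x + y) (h : sin (2 * y) < sin (2 * x)) : x < y := by
  have h1 : sin (2 * x) - sin (2 * y) = 2 * sin (x - y) * cos (x + y) := by
    rw [sin_sub_sin]; congr 3 <;> ring_nf
  have h2 : cos (x + y) < 0 := cos_neg_of_pi_div_two_lt_of_lt hxy (by linarith [hx.2, hy.2])
  by_contra hc
  have h3 : 0 ≤ sin (x - y) :=
    sin_nonneg_of_nonneg_of_le_pi (by linarith) (by linarith [hx.2, hy.1, pi_pos])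
  nlinarith

theorem gt_of_sin_two_mul_lt {x y : ℝ} (hx : x ∈ Ioo 0 (π / 2)) (hy : y ∈ Ioo 0 (π / 2))
    (hxy : x + y < π / 2) (h : sin (2 * y) < sin (2 * x)) : y < x := by
  have h1 : sin (2 * y) = sin (2 * (π / 2 - y)) := by rw [← sin_pi_sub]; ring_nf
  have h2 : sin (2 * x) = sin (2 * (π / 2 - x)) := by rw [← sin_pi_sub]; ring_nf
  have := lt_of_sin_two_mul_lt (x := π / 2 - x) (y := π / 2 - y)
    ⟨by linarith [hx.2], by linarith [hx.1]⟩ ⟨by linarith [hy.2], by linarith [hy.1]⟩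
    (by linarith) (by rwa [← h1, ← h2])
  linarith

theorem sin_two_mul_pos {x : ℝ} (hx : x ∈ Ioo 0 (π / 2)) : 0 < sin (2 * x) :=
  sin_pos_of_pos_of_lt_pi (by linarith [hx.1]) (by linarith [hx.2])

theorem sin_two_mul_lt_of_mass_lt {μ₁ μ₂ x y : ℝ} (hμ : μ₁ < μ₂) (hx : 0 < sin (2 * x))
    (hμ₂ : 0 < μ₂) (h : μ₁ * sin (2 * x) = μ₂ * sin (2 * y)) : sin (2 * y) < sin (2 * x) := by
  have h1 : μ₂ * sin (2 * y) < μ₂ * sin (2 * x) := h ▸ mul_lt_mul_of_pos_right hμ hx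
  exact lt_of_mul_lt_mul_left h1 hμ₂.le

theorem axisAngles_of_smul_add {ω x y : E3} {a b : ℝ} (hx : ‖x‖ = 1) (hy : ‖y‖ = 1)
    (hω : ω = a • x + b • y) (hw : 0 < ‖ω‖) :
    AxisAngles (geoDist x y) a b ‖ω‖ (axisAngle ω x) (axisAngle ω y) ∧
      inner ℝ ω x = a + b * cos (geoDist x y) ∧ inner ℝ ω y = b + a * cos (geoDist x y) := by
  have hxx : inner ℝ x x = 1 := by rw [real_inner_self_eq_norm_sq, hx, one_pow]
  have hyy : inner ℝ y y = 1 := by rw [real_inner_self_eq_norm_sq, hy, one_pow]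
  have hc := (cos_geoDist hx hy).symm
  have hc' : inner ℝ y x = cos (geoDist x y) := by rw [real_inner_comm, hc]
  have h1 : inner ℝ ω x = a + b * cos (geoDist x y) := by
    rw [hω, inner_add_left, real_inner_smul_left, real_inner_smul_left, hxx, hc']; ring
  have h2 : inner ℝ ω y = b + a * cos (geoDist x y) := by
    rw [hω, inner_add_left, real_inner_smul_left, real_inner_smul_left, hyy, hc]; ring
  -- Choosing the smaller of the angles to `ω` and `-ω` replaces the cosine by its absolute value.
  have key : ∀ z : E3, ‖z‖ = 1 → axisAngle ω z ∈ Icc 0 (π / 2) ∧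
      ‖ω‖ * cos (axisAngle ω z) = |inner ℝ ω z| := by
    intro z hz
    have h3 := InnerProductGeometry.cos_angle_mul_norm_mul_norm ω z
    have h4 := InnerProductGeometry.angle_nonneg ω z
    have h5 := InnerProductGeometry.angle_le_pi ω z
    rw [hz, mul_one] at h3
    rw [axisAngle, InnerProductGeometry.angle_neg_left]
    rcases le_total (InnerProductGeometry.angle ω z) (π / 2) with h | h
    · rw [min_eq_left (by linarith), ← h3, abs_of_nonneg (mul_nonneg
        (cos_nonneg_of_neg_pi_div_two_le_of_le (by linarith [pi_pos]) h) hw.le)]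
      exact ⟨⟨h4, h⟩, mul_comm _ _⟩
    · rw [min_eq_right (by linarith), ← h3, cos_pi_sub, abs_of_nonpos
        (mul_nonpos_of_nonpos_of_nonneg (cos_nonpos_of_pi_div_two_le_of_le h (by linarith)) hw.le)]
      exact ⟨⟨by linarith, by linarith⟩, by ring⟩
  refine ⟨⟨hw, ?_, (key x hx).1, (key y hy).1, by rw [(key x hx).2, h1], by rw [(key y hy).2, h2]⟩,
    h1, h2⟩
  rw [← real_inner_self_eq_norm_sq]
  nth_rewrite 2 [hω]
  rw [inner_add_right, real_inner_smul_right, real_inner_smul_right, h1, h2]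
  ring

/-! ### Rotations carrying one pair of unit vectors to another. -/

/-- The right-handed orthonormal frame of two unit vectors at distance `q`. -/
theorem exists_frame {x y : E3} (hx : ‖x‖ = 1) (hy : ‖y‖ = 1) (hq : geoDist x y ∈ Ioo 0 π) :
    ∃ e : OrthonormalBasis (Fin 3) ℝ E3, x = e 0 ∧
      y = cos (geoDist x y) • e 0 + sin (geoDist x y) • e 1 ∧ e 2 = cross (e 0) (e 1) := by
  have hs : 0 < sin (geoDist x y) := sin_pos_of_mem_Ioo hq
  have hsc := sin_sq_add_cos_sq (geoDist x y)
  have hc := (cos_geoDist hx hy).symm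
  generalize geoDist x y = q at *
  have hxx : inner ℝ x x = 1 := by rw [real_inner_self_eq_norm_sq, hx, one_pow]
  have hyy : inner ℝ y y = 1 := by rw [real_inner_self_eq_norm_sq, hy, one_pow]
  have hc' : inner ℝ y x = cos q := by rw [real_inner_comm, hc]
  set u : E3 := (sin q)⁻¹ • (y - cos q • x) with hu
  have hxu : inner ℝ x u = 0 := by
    rw [hu, real_inner_smul_right, inner_sub_right, real_inner_smul_right, hxx, hc]; ring
  have hux : inner ℝ u x = 0 := by rw [real_inner_comm, hxu]
  have huu : inner ℝ u u = 1 := by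
    rw [hu, real_inner_smul_right, real_inner_smul_left]
    simp only [inner_sub_right, inner_sub_left, real_inner_smul_right, real_inner_smul_left, hxx,
      hyy, hc, hc']
    field_simp
    linarith
  have hon : Orthonormal ℝ ![x, u, cross x u] := by
    rw [orthonormal_iff_ite]
    intro i j
    fin_cases i <;> fin_cases j <;>
      simp only [Fin.zero_eta, Fin.mk_one, Fin.reduceFinMk, Matrix.cons_val, hxx, hxu, hux, huu,
        inner_cross_cross, inner_cross_self_left, inner_cross_self_right,
        real_inner_comm (cross x u) x, real_inner_comm (cross x u) u] <;> norm_num <;> decide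
  have hcard : Fintype.card (Fin 3) = Module.finrank ℝ E3 := by simp
  let B : OrthonormalBasis (Fin 3) ℝ E3 := OrthonormalBasis.mk hon (by
    rw [← coe_basisOfOrthonormalOfCardEqFinrank hon hcard]
    exact (Module.Basis.span_eq _).ge)
  have hB : ∀ i, B i = ![x, u, cross x u] i := fun i => by
    simp [B]
  refine ⟨B, by rw [hB]; rfl, ?_, by rw [hB, hB, hB]; rfl⟩
  rw [hB, hB]
  simp only [Matrix.cons_val, hu]
  rw [smul_smul, mul_inv_cancel₀ hs.ne', one_smul]
  abel

/-- The determinant is the triple product `⟨e₀ × e₁, e₂⟩ = ‖e₂‖²`. -/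
theorem det_frame (e : OrthonormalBasis (Fin 3) ℝ E3) (he : e 2 = cross (e 0) (e 1)) :
    (EuclideanSpace.basisFun (Fin 3) ℝ).toBasis.det e = 1 := by
  have h1 : inner ℝ (e 2) (e 2) = 1 := by
    rw [real_inner_self_eq_norm_sq, e.orthonormal.1, one_pow]
  nth_rewrite 1 [he] at h1
  rw [Module.Basis.det_apply, Matrix.det_fin_three]
  simp only [Module.Basis.toMatrix_apply, OrthonormalBasis.coe_toBasis_repr_apply,
    EuclideanSpace.basisFun_repr]
  simp only [inner_eq_sum, cross_apply_zero, cross_apply_one, cross_apply_two] at h1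
  linear_combination h1

/-- A rotation carries a pair of unit vectors to any other pair at the same distance. -/
theorem exists_rotation {x y x' y' : E3} (hx : ‖x‖ = 1) (hy : ‖y‖ = 1) (hx' : ‖x'‖ = 1)
    (hy' : ‖y'‖ = 1) (hq : geoDist x y ∈ Ioo 0 π) (hqq : geoDist x' y' = geoDist x y) :
    ∃ R : E3 ≃ₗᵢ[ℝ] E3, LinearMap.det (R.toLinearEquiv : E3 →ₗ[ℝ] E3) = 1 ∧
      R x = x' ∧ R y = y' ∧
      ∀ a b : ℝ, ∀ z, R (cross (a • x + b • y) z) = cross (a • x' + b • y') (R z) := by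
  obtain ⟨e, h0, h1, h2⟩ := exists_frame hx hy hq
  obtain ⟨e', h0', h1', h2'⟩ := exists_frame hx' hy' (by rwa [hqq])
  rw [hqq] at h1'
  generalize geoDist x y = q at *
  have hR : ∀ i, e.equiv e' (Equiv.refl _) (e i) = e' i := fun i => by simp
  have hRx : e.equiv e' (Equiv.refl _) x = x' := by rw [h0, h0', hR]
  have hRy : e.equiv e' (Equiv.refl _) y = y' := by
    rw [h1, h1', map_add, map_smul, map_smul, hR, hR]
  refine ⟨e.equiv e' (Equiv.refl _), ?_, hRx, hRy, ?_⟩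
  · have h3 := Module.Basis.det_comp (EuclideanSpace.basisFun (Fin 3) ℝ).toBasis
      ((e.equiv e' (Equiv.refl _)).toLinearEquiv : E3 →ₗ[ℝ] E3) e
    have h4 : ((e.equiv e' (Equiv.refl _)).toLinearEquiv : E3 →ₗ[ℝ] E3) ∘ e = e' := by
      funext i; exact hR i
    rw [h4, det_frame e h2, det_frame e' h2', mul_one] at h3
    exact h3.symm
  · intro a b z
    -- The product with a vector of the plane spanned by the first two frame vectors has the same
    -- coordinates in every right-handed frame; this is the compatibility of `R` with the vector
    -- product that is needed.
    have h3 : ∀ (e : OrthonormalBasis (Fin 3) ℝ E3), e 2 = cross (e 0) (e 1) → ∀ α β : ℝ,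
        cross (α • e 0 + β • e 1) (e 0) = (-β) • e 2 ∧
        cross (α • e 0 + β • e 1) (e 1) = α • e 2 ∧
        cross (α • e 0 + β • e 1) (e 2) = β • e 0 - α • e 1 := by
      intro e he α β
      have i0 : inner ℝ (e 0) (e 0) = 1 := by
        rw [real_inner_self_eq_norm_sq, e.orthonormal.1, one_pow]
      have i1 : inner ℝ (e 1) (e 1) = 1 := by
        rw [real_inner_self_eq_norm_sq, e.orthonormal.1, one_pow]
      have i01 : inner ℝ (e 0) (e 1) = 0 := e.orthonormal.2 (by decide)
      have i10 : inner ℝ (e 1) (e 0) = 0 := e.orthonormal.2 (by decide)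
      refine ⟨?_, ?_, ?_⟩
      · rw [he]
        apply ext_coords <;>
        simp [cross_apply_zero, cross_apply_one, cross_apply_two] <;> ring
      · rw [he]
        apply ext_coords <;>
        simp [cross_apply_zero, cross_apply_one, cross_apply_two] <;> ring
      · rw [he, cross_cross_right, inner_add_left, inner_add_left, real_inner_smul_left,
          real_inner_smul_left, real_inner_smul_left, real_inner_smul_left, i0, i1, i01, i10]
        simp
    have h4 : (a • x + b • y) = (a + b * cos q) • e 0 + (b * sin q) • e 1 := by
      rw [h0, h1, ← h0]; module
    have h5 : (a • x' + b • y') = (a + b * cos q) • e' 0 + (b * sin q) • e' 1 := by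
      rw [h0', h1', ← h0']; module
    rw [h4, h5]
    obtain ⟨k0, k1, k2⟩ := h3 e h2 (a + b * cos q) (b * sin q)
    obtain ⟨k0', k1', k2'⟩ := h3 e' h2' (a + b * cos q) (b * sin q)
    let f : E3 →ₗ[ℝ] E3 := ((e.equiv e' (Equiv.refl _)).toLinearEquiv : E3 →ₗ[ℝ] E3) ∘ₗ
      (rotGen ((a + b * cos q) • e 0 + (b * sin q) • e 1) : E3 →ₗ[ℝ] E3)
    let g : E3 →ₗ[ℝ] E3 := (rotGen ((a + b * cos q) • e' 0 + (b * sin q) • e' 1) : E3 →ₗ[ℝ] E3) ∘ₗ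
      ((e.equiv e' (Equiv.refl _)).toLinearEquiv : E3 →ₗ[ℝ] E3)
    have hfg : f = g := by
      refine e.toBasis.ext fun i => ?_
      change e.equiv e' (Equiv.refl _) (cross _ (e.toBasis i)) =
        cross _ (e.equiv e' (Equiv.refl _) (e.toBasis i))
      rw [OrthonormalBasis.coe_toBasis, hR]
      fin_cases i
      · change e.equiv e' (Equiv.refl _) (cross _ (e 0)) = cross _ (e' 0)
        rw [k0, k0', map_smul, hR]
      · change e.equiv e' (Equiv.refl _) (cross _ (e 1)) = cross _ (e' 1)
        rw [k1, k1', map_smul, hR]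
      · change e.equiv e' (Equiv.refl _) (cross _ (e 2)) = cross _ (e' 2)
        rw [k2, k2', map_sub, map_smul, map_smul, hR, hR]
    exact congrArg (fun f : E3 →ₗ[ℝ] E3 => f z) hfg

/-! ### Existence, uniqueness and geometry of the relative equilibria. -/

theorem IsRepelling.differentiableAt {V : ℝ → ℝ} (hV : IsRepelling V) {q : ℝ} (hq : q ∈ Ioo 0 π) :
    DifferentiableAt ℝ V q :=
  (hV.1.differentiableOn (by simp)).differentiableAt (isOpen_Ioo.mem_nhds hq)

theorem IsRepelling.exists_isRE {μ₁ μ₂ : ℝ} (hμ₁ : 0 < μ₁) (hμ₂ : 0 < μ₂) {V : ℝ → ℝ}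
    (hV : IsRepelling V) {q : ℝ} (hq : q ∈ Ioo 0 π) (hq2 : q ≠ π / 2) :
    ∃ x₁ x₂ : ℝ → E3, IsRE μ₁ μ₂ V x₁ x₂ ∧ geoDist (x₁ 0) (x₂ 0) = q := by
  have hc : cos q ≠ 0 := by
    rw [← cos_pi_div_two]
    exact fun h => hq2 (injOn_cos ⟨hq.1.le, hq.2.le⟩ ⟨by positivity, by linarith [pi_pos]⟩ h)
  obtain ⟨a, b, hB⟩ := exists_balanced_coeff hμ₁ hμ₂ hq (hV.2 q hq) hc
  set x : E3 := WithLp.toLp 2 ![1, 0, 0]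
  set y : E3 := WithLp.toLp 2 ![cos q, sin q, 0]
  have hx : ‖x‖ = 1 := by simp [x, EuclideanSpace.norm_eq, Fin.sum_univ_three]
  have hy : ‖y‖ = 1 := by simp [y, EuclideanSpace.norm_eq, Fin.sum_univ_three]
  have hg : geoDist x y = q := by
    have : inner ℝ x y = cos q := by simp [inner_eq_sum, x, y]
    rw [geoDist, this, arccos_cos hq.1.le hq.2.le]
  refine ⟨fun t => rot (a • x + b • y) t x, fun t => rot (a • x + b • y) t y,
    ⟨isMotion_of_balanced hx hy (by rwa [hg]) (by rw [hg]; exact hV.differentiableAt hq)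
      (by rwa [hg]), a • x + b • y, fun t => ?_⟩, ?_⟩
  · simp [rot_zero]
  · simp [rot_zero, hg]

theorem IsRepelling.exists_balanced {μ₁ μ₂ : ℝ} (hμ₁ : 0 < μ₁) {V : ℝ → ℝ} (hV : IsRepelling V)
    {x₁ x₂ : ℝ → E3} {ω : E3} (hm : IsMotion μ₁ μ₂ V x₁ x₂) (hr : RotatesWith ω x₁ x₂) :
    ∃ a b : ℝ, ω = a • x₁ 0 + b • x₂ 0 ∧
      Balanced μ₁ μ₂ (geoDist (x₁ 0) (x₂ 0)) (deriv V (geoDist (x₁ 0) (x₂ 0))) a b :=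
  TwoBody.exists_balanced hμ₁ hm hr (hV.differentiableAt (hm.dist_mem 0))
    (hV.2 _ (hm.dist_mem 0)).ne

theorem IsRepelling.dist_ne_pi_div_two {μ₁ μ₂ : ℝ} (hμ₁ : 0 < μ₁) (hne : μ₁ ≠ μ₂) {V : ℝ → ℝ}
    (hV : IsRepelling V) {x₁ x₂ : ℝ → E3} (h : IsRE μ₁ μ₂ V x₁ x₂) :
    geoDist (x₁ 0) (x₂ 0) ≠ π / 2 := by
  obtain ⟨hm, ω, hr⟩ := h
  obtain ⟨a, b, -, hB⟩ := hV.exists_balanced hμ₁ hm hr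
  intro hq
  have := hB.cos_ne_zero hne (hV.2 _ (hm.dist_mem 0))
  rw [hq, cos_pi_div_two] at this
  exact this rfl

theorem IsRepelling.sameUpToSymmetry {μ₁ μ₂ : ℝ} (hμ₁ : 0 < μ₁) (hμ₂ : 0 < μ₂) (hne : μ₁ ≠ μ₂)
    {V : ℝ → ℝ} (hV : IsRepelling V) {x₁ x₂ y₁ y₂ : ℝ → E3} (hx : IsRE μ₁ μ₂ V x₁ x₂)
    (hy : IsRE μ₁ μ₂ V y₁ y₂) (hq : geoDist (y₁ 0) (y₂ 0) = geoDist (x₁ 0) (x₂ 0)) :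
    SameUpToSymmetry x₁ x₂ y₁ y₂ := by
  obtain ⟨hm, ω, hr⟩ := hx
  obtain ⟨hm', ω', hr'⟩ := hy
  obtain ⟨a, b, hω, hB⟩ := hV.exists_balanced hμ₁ hm hr
  obtain ⟨a', b', hω', hB'⟩ := hV.exists_balanced hμ₁ hm' hr'
  rw [hq] at hB'
  obtain ⟨R, hdet, hRx, hRy, hR⟩ := exists_rotation (hm.sphere₁ 0) (hm.sphere₂ 0) (hm'.sphere₁ 0)
    (hm'.sphere₂ 0) (hm.dist_mem 0) hq
  -- The sign left open by the balance equations becomes the reversal of time.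
  obtain ⟨s, hs, ha, hb⟩ : ∃ s : ℝ, (s = 1 ∨ s = -1) ∧ a' = s * a ∧ b' = s * b := by
    rcases hB.unique hB' hμ₁ hμ₂ hne (hm.dist_mem 0) (hV.2 _ (hm.dist_mem 0))
      with ⟨h1, h2⟩ | ⟨h1, h2⟩
    · exact ⟨1, Or.inl rfl, by simp [h1], by simp [h2]⟩
    · exact ⟨-1, Or.inr rfl, by simp [h1], by simp [h2]⟩
  have hi : ∀ z, (R.toContinuousLinearEquiv : E3 →L[ℝ] E3) (s • cross ω z) =
      cross ω' ((R.toContinuousLinearEquiv : E3 →L[ℝ] E3) z) := by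
    intro z
    have h1 : s • cross ω z = cross ((s * a) • x₁ 0 + (s * b) • x₂ 0) z := by
      rw [hω]
      apply ext_coords <;>
      simp [cross_apply_zero, cross_apply_one, cross_apply_two] <;> ring
    rw [h1, hω', ha, hb]
    exact hR _ _ _
  refine ⟨R, s, hdet, hs, fun t => ⟨?_, ?_⟩⟩
  · rw [(hr' t).1, (hr (s * t)).1, ← hRx]
    exact (rot_intertwine (R.toContinuousLinearEquiv : E3 →L[ℝ] E3) s hi t (x₁ 0)).symm
  · rw [(hr' t).2, (hr (s * t)).2, ← hRy]
    exact (rot_intertwine (R.toContinuousLinearEquiv : E3 →L[ℝ] E3) s hi t (x₂ 0)).symm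

theorem Balanced.smul_add_ne_zero {μ₁ μ₂ q F a b : ℝ} {x y : E3} (hB : Balanced μ₁ μ₂ q F a b)
    (hμ₁ : 0 < μ₁) (hq : q ∈ Ioo 0 π) (hF : F < 0) (hx : ‖x‖ = 1) (hc : inner ℝ y x = cos q) :
    a • x + b • y ≠ 0 := by
  intro h0
  have h1 : inner ℝ (a • x + b • y) x = a + b * cos q := by
    rw [inner_add_left, real_inner_smul_left, real_inner_smul_left, hc, real_inner_self_eq_norm_sq,
      hx]
    ring
  have h2 := hB.mul_lt_zero₁ hμ₁ hq hF
  rw [← h1, h0, inner_zero_left, mul_zero] at h2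
  exact h2.false

/-- The axis of rotation of a relative equilibrium lies in the plane of the two particles. -/
theorem IsRepelling.axisAngles {μ₁ μ₂ : ℝ} (hμ₁ : 0 < μ₁) {V : ℝ → ℝ} (hV : IsRepelling V)
    {x₁ x₂ : ℝ → E3} {ω : E3} (hm : IsMotion μ₁ μ₂ V x₁ x₂) (hr : RotatesWith ω x₁ x₂) :
    ∃ a b : ℝ, ω = a • x₁ 0 + b • x₂ 0 ∧
      Balanced μ₁ μ₂ (geoDist (x₁ 0) (x₂ 0)) (deriv V (geoDist (x₁ 0) (x₂ 0))) a b ∧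
      AxisAngles (geoDist (x₁ 0) (x₂ 0)) a b ‖ω‖ (axisAngle ω (x₁ 0)) (axisAngle ω (x₂ 0)) ∧
      inner ℝ ω (x₁ 0) = a + b * cos (geoDist (x₁ 0) (x₂ 0)) ∧
      inner ℝ ω (x₂ 0) = b + a * cos (geoDist (x₁ 0) (x₂ 0)) := by
  obtain ⟨a, b, hω, hB⟩ := hV.exists_balanced hμ₁ hm hr
  have hc := cos_geoDist (hm.sphere₁ 0) (hm.sphere₂ 0)
  have hw : 0 < ‖ω‖ := by
    rw [norm_pos_iff, hω]
    exact hB.smul_add_ne_zero hμ₁ (hm.dist_mem 0) (hV.2 _ (hm.dist_mem 0)) (hm.sphere₁ 0)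
      (by rw [real_inner_comm, hc])
  exact ⟨a, b, hω, hB, axisAngles_of_smul_add (hm.sphere₁ 0) (hm.sphere₂ 0) hω hw⟩

theorem Balanced.axis_facts {μ₁ μ₂ q F a b w θ₁ θ₂ : ℝ} (hB : Balanced μ₁ μ₂ q F a b)
    (hA : AxisAngles q a b w θ₁ θ₂) (hμ₁ : 0 < μ₁) (hμ₂ : 0 < μ₂) (hq : q ∈ Ioo 0 π) (hF : F < 0) :
    θ₁ ∈ Ioo 0 (π / 2) ∧ θ₂ ∈ Ioo 0 (π / 2) ∧ q = π - (θ₁ + θ₂) ∧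
      μ₁ * sin (2 * θ₁) = μ₂ * sin (2 * θ₂) := by
  have h1 := hB.mul_lt_zero₁ hμ₁ hq hF
  have h2 := hB.mul_lt_zero₂ hμ₂ hq hF
  refine ⟨hA.mem_Ioo₁ hq (left_ne_zero_of_mul h1.ne) (right_ne_zero_of_mul h1.ne),
    hA.swap.mem_Ioo₁ hq (left_ne_zero_of_mul h2.ne) (right_ne_zero_of_mul h2.ne),
    hA.dist_eq hB hμ₁ hμ₂ hq hF, ?_⟩
  have h3 := hA.speed_sq_mul_sin₁ hB hμ₁ hq hF
  rw [← hA.speed_sq_mul_sin₂ hB hμ₂ hq hF] at h3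
  have := mul_left_cancel₀ (pow_ne_zero 2 hA.speed_pos.ne') h3
  linarith

theorem IsRepelling.axis_description {μ₁ μ₂ : ℝ} (hμ₁ : 0 < μ₁) (hμ₂ : 0 < μ₂) {V : ℝ → ℝ}
    (hV : IsRepelling V) {x₁ x₂ : ℝ → E3} {ω : E3} {q θ₁ θ₂ : ℝ}
    (hm : IsMotion μ₁ μ₂ V x₁ x₂) (hr : RotatesWith ω x₁ x₂) (hqd : q = geoDist (x₁ 0) (x₂ 0))
    (hθ₁ : θ₁ = axisAngle ω (x₁ 0)) (hθ₂ : θ₂ = axisAngle ω (x₂ 0)) :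
    θ₁ ∈ Ioo 0 (π / 2) ∧ θ₂ ∈ Ioo 0 (π / 2) ∧
    q = π - (θ₁ + θ₂) ∧
    inner ℝ ω (x₁ 0) * inner ℝ ω (x₂ 0) < 0 ∧
    μ₁ * sin (2 * θ₁) = μ₂ * sin (2 * θ₂) ∧
    (q < π / 2 → (μ₁ < μ₂ → θ₁ < θ₂) ∧ (μ₂ < μ₁ → θ₂ < θ₁)) ∧
    (π / 2 < q → (μ₁ < μ₂ → θ₂ < θ₁) ∧ (μ₂ < μ₁ → θ₁ < θ₂)) ∧
    ‖ω‖ ^ 2 = (1 / 2 * μ₁ * sin (2 * θ₁))⁻¹ * (- deriv V q) ∧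
    ‖ω‖ ^ 2 = (1 / 2 * μ₂ * sin (2 * θ₂))⁻¹ * (- deriv V q) := by
  obtain ⟨a, b, -, hB, hA, hi₁, hi₂⟩ := hV.axisAngles hμ₁ hm hr
  have hq := hm.dist_mem 0
  rw [← hqd] at hq hB hA hi₁ hi₂
  rw [← hθ₁, ← hθ₂] at hA
  have hF := hV.2 q hq
  obtain ⟨h1, h2, h3, h4⟩ := hB.axis_facts hA hμ₁ hμ₂ hq hF
  have s1 := sin_two_mul_pos h1
  have s2 := sin_two_mul_pos h2
  refine ⟨h1, h2, h3, by rw [hi₁, hi₂]; exact hB.hemispheres hμ₁ hμ₂ hq hF, h4,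
    fun h => ⟨fun hμ => ?_, fun hμ => ?_⟩, fun h => ⟨fun hμ => ?_, fun hμ => ?_⟩, ?_, ?_⟩
  · exact lt_of_sin_two_mul_lt h1 h2 (by linarith) (sin_two_mul_lt_of_mass_lt hμ s1 hμ₂ h4)
  · exact lt_of_sin_two_mul_lt h2 h1 (by linarith) (sin_two_mul_lt_of_mass_lt hμ s2 hμ₁ h4.symm)
  · exact gt_of_sin_two_mul_lt h1 h2 (by linarith) (sin_two_mul_lt_of_mass_lt hμ s1 hμ₂ h4)
  · exact gt_of_sin_two_mul_lt h2 h1 (by linarith) (sin_two_mul_lt_of_mass_lt hμ s2 hμ₁ h4.symm)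
  · rw [eq_inv_mul_iff_mul_eq₀ (by positivity), mul_comm]
    exact hA.speed_sq_mul_sin₁ hB hμ₁ hq hF
  · rw [eq_inv_mul_iff_mul_eq₀ (by positivity), mul_comm]
    exact hA.speed_sq_mul_sin₂ hB hμ₂ hq hF

/-! ### The reduced system for the potential `cot` and its linearization. -/

/-- In terms of `k = cot q` the energy is polynomial, and `k' = -(1 + k²)` keeps every derivative
polynomial in `k`. -/
theorem hamiltonian_cot {μ₁ μ₂ : ℝ} (hμ₁ : μ₁ ≠ 0) (hμ₂ : μ₂ ≠ 0) {z : Fin 5 → ℝ}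
    (hz : sin (z 0) ≠ 0) :
    hamiltonian μ₁ μ₂ Real.cot z = 1 / 2 * ((z 1) ^ 2 / μ₂ + (z 1 - z 2) ^ 2 / μ₁ +
      (z 3 - cot (z 0) * z 4) ^ 2 / μ₁ + (z 4) ^ 2 * (1 + cot (z 0) ^ 2) / μ₂) + cot (z 0) := by
  have h1 := sin_sq_add_cos_sq (z 0)
  have h2 : (μ₁ + μ₂ * cos (z 0) ^ 2) / sin (z 0) ^ 2 =
      μ₁ * (1 + cot (z 0) ^ 2) + μ₂ * cot (z 0) ^ 2 := by
    rw [cot_eq_cos_div_sin]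
    field_simp
    linear_combination (-μ₁) * h1
  have h3 : μ₂ * cos (z 0) / sin (z 0) = μ₂ * cot (z 0) := by
    rw [cot_eq_cos_div_sin]; ring
  rw [hamiltonian, invMassMatrix, h2, h3]
  simp [Matrix.mulVec, dotProduct, Fin.sum_univ_four]
  field_simp
  ring

theorem hasDerivAt_cot {q : ℝ} (hq : sin q ≠ 0) : HasDerivAt cot (-(1 + cot q ^ 2)) q := by
  have h1 := (hasDerivAt_cos q).div (hasDerivAt_sin q) hq
  have h2 : cot = cos / sin := funext fun x => cot_eq_cos_div_sin x
  rw [h2]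
  refine h1.congr_deriv ?_
  simp only [Pi.div_apply]
  field_simp
  ring

/-- The gradient of the reduced Hamiltonian for the potential `cot`. -/
noncomputable def cotGradient (μ₁ μ₂ : ℝ) (z : Fin 5 → ℝ) : Fin 5 → ℝ :=
  ![(1 + cot (z 0) ^ 2) *
      ((z 3 - cot (z 0) * z 4) * z 4 / μ₁ - z 4 ^ 2 * cot (z 0) / μ₂ - 1),
    z 1 / μ₂ + (z 1 - z 2) / μ₁,
    (z 2 - z 1) / μ₁,
    (z 3 - cot (z 0) * z 4) / μ₁,
    -(cot (z 0) * (z 3 - cot (z 0) * z 4) / μ₁) + z 4 * (1 + cot (z 0) ^ 2) / μ₂]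

theorem hasFDerivAt_coord (i : Fin 5) (z : Fin 5 → ℝ) :
    HasFDerivAt (fun z : Fin 5 → ℝ => z i)
      (ContinuousLinearMap.proj (R := ℝ) (φ := fun _ : Fin 5 => ℝ) i) z :=
  (ContinuousLinearMap.proj (R := ℝ) (φ := fun _ : Fin 5 => ℝ) i).hasFDerivAt

theorem hasFDerivAt_cot_coord {z : Fin 5 → ℝ} (hz : sin (z 0) ≠ 0) :
    HasFDerivAt (fun z : Fin 5 → ℝ => cot (z 0))
      ((-(1 + cot (z 0) ^ 2)) • ContinuousLinearMap.proj (R := ℝ) (φ := fun _ : Fin 5 => ℝ) 0) z :=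
  HasDerivAt.comp_hasFDerivAt (f := fun z : Fin 5 → ℝ => z 0) z (hasDerivAt_cot hz)
    (hasFDerivAt_coord 0 z)

theorem eventually_sin_ne_zero {z : Fin 5 → ℝ} (hz : sin (z 0) ≠ 0) :
    ∀ᶠ y in nhds z, sin (y 0) ≠ 0 :=
  (show Continuous fun y : Fin 5 → ℝ => sin (y 0) by fun_prop).continuousAt.eventually_ne hz

theorem pderiv_hamiltonian_cot {μ₁ μ₂ : ℝ} (hμ₁ : μ₁ ≠ 0) (hμ₂ : μ₂ ≠ 0) {z : Fin 5 → ℝ}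
    (hz : sin (z 0) ≠ 0) (i : Fin 5) :
    pderiv (hamiltonian μ₁ μ₂ Real.cot) i z = cotGradient μ₁ μ₂ z i := by
  have hk := hasFDerivAt_cot_coord hz
  have h1 := hasFDerivAt_coord 1 z
  have h2 := hasFDerivAt_coord 2 z
  have h3 := hasFDerivAt_coord 3 z
  have h4 := hasFDerivAt_coord 4 z
  have hH := ((((((h1.pow 2).mul_const μ₂⁻¹).add (((h1.sub h2).pow 2).mul_const μ₁⁻¹)).add
    (((h3.sub (hk.mul h4)).pow 2).mul_const μ₁⁻¹)).add
    (((h4.pow 2).mul ((hk.pow 2).const_add 1)).mul_const μ₂⁻¹)).const_mul (1 / 2)).add hk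
  have hH' := hH.congr_of_eventuallyEq (f₁ := hamiltonian μ₁ μ₂ Real.cot)
    ((eventually_sin_ne_zero hz).mono fun y hy => by
      rw [hamiltonian_cot hμ₁ hμ₂ hy]
      simp [div_eq_mul_inv])
  rw [pderiv, hH'.fderiv]
  fin_cases i <;> simp [cotGradient] <;> field_simp <;> ring

theorem reducedField_cot {μ₁ μ₂ : ℝ} (hμ₁ : μ₁ ≠ 0) (hμ₂ : μ₂ ≠ 0) {z : Fin 5 → ℝ}
    (hz : sin (z 0) ≠ 0) :
    reducedField μ₁ μ₂ Real.cot z =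
      ![cotGradient μ₁ μ₂ z 1,
        -cotGradient μ₁ μ₂ z 0,
        z 3 * cotGradient μ₁ μ₂ z 4 - z 4 * cotGradient μ₁ μ₂ z 3,
        z 4 * cotGradient μ₁ μ₂ z 2 - z 2 * cotGradient μ₁ μ₂ z 4,
        z 2 * cotGradient μ₁ μ₂ z 3 - z 3 * cotGradient μ₁ μ₂ z 2] := by
  simp only [reducedField, pderiv_hamiltonian_cot hμ₁ hμ₂ hz]

/-- A matrix which exchanges the span of the coordinates `0, 3, 4` with that of `1, 2`. -/
def antiBlock {R : Type*} [Zero R] (a d e : Fin 2 → R) (b c : Fin 3 → R) :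
    Matrix (Fin 5) (Fin 5) R :=
  !![0, a 0, a 1, 0, 0;
     b 0, 0, 0, b 1, b 2;
     c 0, 0, 0, c 1, c 2;
     0, d 0, d 1, 0, 0;
     0, e 0, e 1, 0, 0]

/-- The linearization of the reduced equations for the potential `cot` at the point
`(q, 0, 0, m₂, m₃)`, where `k = cot q`. -/
noncomputable def cotMatrix (μ₁ μ₂ k m₂ m₃ : ℝ) : Matrix (Fin 5) (Fin 5) ℝ :=
  antiBlock ![1 / μ₂ + 1 / μ₁, -(1 / μ₁)]
    ![-(m₃ / μ₁),
      m₃ / μ₁ - (-(k * (m₂ - k * m₃) / μ₁) + m₃ * (1 + k ^ 2) / μ₂)]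
    ![m₂ / μ₁, (m₂ - k * m₃) / μ₁ - m₂ / μ₁]
    ![2 * k * (1 + k ^ 2) * ((m₂ - k * m₃) * m₃ / μ₁ - m₃ ^ 2 * k / μ₂ - 1) -
        (1 + k ^ 2) ^ 2 * m₃ ^ 2 * (1 / μ₁ + 1 / μ₂),
      -((1 + k ^ 2) * m₃ / μ₁),
      -((1 + k ^ 2) * ((m₂ - 2 * k * m₃) / μ₁ - 2 * k * m₃ / μ₂))]
    ![m₂ * ((1 + k ^ 2) * ((m₂ - 2 * k * m₃) / μ₁ - 2 * k * m₃ / μ₂)) -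
        m₃ * ((1 + k ^ 2) * m₃ / μ₁),
      -(k * (m₂ - k * m₃) / μ₁) + m₃ * (1 + k ^ 2) / μ₂ - m₂ * k / μ₁ - m₃ / μ₁,
      m₂ * (k ^ 2 / μ₁ + (1 + k ^ 2) / μ₂) - (m₂ - k * m₃) / μ₁ + m₃ * k / μ₁]

set_option linter.unusedSimpArgs false in
theorem hasFDerivAt_reducedField_cot {μ₁ μ₂ : ℝ} (hμ₁ : μ₁ ≠ 0) (hμ₂ : μ₂ ≠ 0) {q m₂ m₃ : ℝ}
    (hq : sin q ≠ 0) :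
    HasFDerivAt (reducedField μ₁ μ₂ Real.cot)
      (LinearMap.toContinuousLinearMap (Matrix.toLin' (cotMatrix μ₁ μ₂ (cot q) m₂ m₃)))
      ![q, 0, 0, m₂, m₃] := by
  set z : Fin 5 → ℝ := ![q, 0, 0, m₂, m₃]
  have hz : sin (z 0) ≠ 0 := hq
  have z0 : z 0 = q := rfl
  have z1 : z 1 = 0 := rfl
  have z2 : z 2 = 0 := rfl
  have z3 : z 3 = m₂ := rfl
  have z4 : z 4 = m₃ := rfl
  have hk := hasFDerivAt_cot_coord hz
  have h1 := hasFDerivAt_coord 1 z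
  have h2 := hasFDerivAt_coord 2 z
  have h3 := hasFDerivAt_coord 3 z
  have h4 := hasFDerivAt_coord 4 z
  have hD := (hk.pow 2).const_add 1
  have hn := h3.sub (hk.mul h4)
  have hH0 := hD.mul ((((hn.mul h4).mul_const μ₁⁻¹).sub
    (((h4.pow 2).mul hk).mul_const μ₂⁻¹)).sub_const 1)
  have hH1 := (h1.mul_const μ₂⁻¹).add ((h1.sub h2).mul_const μ₁⁻¹)
  have hH2 := (h2.sub h1).mul_const μ₁⁻¹
  have hH3 := hn.mul_const μ₁⁻¹
  have hH4 := ((hk.mul hn).mul_const μ₁⁻¹).neg.add ((h4.mul hD).mul_const μ₂⁻¹)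
  refine hasFDerivAt_pi'' fun i => ?_
  have hev := eventually_sin_ne_zero hz
  fin_cases i
  -- Each `refine` splits its goal in two; going from the last goal to the first keeps the remaining
  -- numbers valid.
  on_goal 5 =>
    refine (((h2.mul hH3).sub (h3.mul hH2)).congr_fderiv ?_).congr_of_eventuallyEq
      (hev.mono fun y hy => ?_)
  on_goal 4 =>
    refine (((h4.mul hH2).sub (h2.mul hH4)).congr_fderiv ?_).congr_of_eventuallyEq
      (hev.mono fun y hy => ?_)
  on_goal 3 =>
    refine (((h3.mul hH4).sub (h4.mul hH3)).congr_fderiv ?_).congr_of_eventuallyEq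
      (hev.mono fun y hy => ?_)
  on_goal 2 => refine (hH0.neg.congr_fderiv ?_).congr_of_eventuallyEq (hev.mono fun y hy => ?_)
  on_goal 1 => refine (hH1.congr_fderiv ?_).congr_of_eventuallyEq (hev.mono fun y hy => ?_)
  all_goals first
    | simp [reducedField_cot hμ₁ hμ₂ hy, cotGradient, div_eq_mul_inv]
    | ext v
      simp [z0, z1, z2, z3, z4, cotMatrix, antiBlock, dotProduct, Fin.sum_univ_five]
      ring

theorem linearization_cot {μ₁ μ₂ : ℝ} (hμ₁ : μ₁ ≠ 0) (hμ₂ : μ₂ ≠ 0) {q m₂ m₃ : ℝ}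
    (hq : sin q ≠ 0) :
    linearization μ₁ μ₂ Real.cot ![q, 0, 0, m₂, m₃] =
      (cotMatrix μ₁ μ₂ (cot q) m₂ m₃).map (fun a : ℝ => (a : ℂ)) := by
  rw [linearization, (hasFDerivAt_reducedField_cot hμ₁ hμ₂ hq).fderiv]
  congr 1
  exact LinearMap.toMatrix'_toLin' _

open Polynomial in
-- The square of the matrix maps the span of coordinates `1, 2` to itself by a `2 × 2` matrix; its
-- characteristic polynomial, evaluated at `X²`, is the second factor.
theorem charpoly_antiBlock {R : Type*} [CommRing R] (a d e : Fin 2 → R) (b c : Fin 3 → R) :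
    (antiBlock a d e b c).charpoly = X * (X ^ 4 -
      C (b 0 * a 0 + b 1 * d 0 + b 2 * e 0 + (c 0 * a 1 + c 1 * d 1 + c 2 * e 1)) * X ^ 2 +
      C ((b 0 * a 0 + b 1 * d 0 + b 2 * e 0) * (c 0 * a 1 + c 1 * d 1 + c 2 * e 1) -
        (b 0 * a 1 + b 1 * d 1 + b 2 * e 1) * (c 0 * a 0 + c 1 * d 0 + c 2 * e 0))) := by
  rw [Matrix.charpoly]
  have h : (antiBlock a d e b c).charmatrix =
      !![X, -C (a 0), -C (a 1), 0, 0;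
         -C (b 0), X, 0, -C (b 1), -C (b 2);
         -C (c 0), 0, X, -C (c 1), -C (c 2);
         0, -C (d 0), -C (d 1), X, 0;
         0, -C (e 0), -C (e 1), 0, X] := by
    ext1 i j
    fin_cases i <;> fin_cases j <;> simp [antiBlock]
  rw [h]
  simp [Matrix.det_succ_row_zero, Fin.sum_univ_succ, Fin.succAbove]
  ring

open Polynomial in
/-- At a relative equilibrium for the potential `cot` with `tan θ_j = t_j`, where `h` is the
component of the angular velocity along `-x₁`. -/
theorem charpoly_cotMatrix {t₁ t₂ h : ℝ} (ht₁ : 0 < t₁) (ht₂ : 0 < t₂) (hh : h ≠ 0)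
    {k ζ μ₁ μ₂ m₂ m₃ : ℝ} (hk : k = (t₁ * t₂ - 1) / (t₁ + t₂))
    (hζ : ζ = (1 + t₂ ^ 2) / (h ^ 2 * (t₁ + t₂) ^ 2))
    (hμ₁ : μ₁ = ζ * (1 + t₁ ^ 2) / t₁) (hμ₂ : μ₂ = ζ * (1 + t₂ ^ 2) / t₂)
    (hm₃ : m₃ = h * ζ * (t₁ + t₂)) (hm₂ : m₂ = t₁ * m₃) :
    (cotMatrix μ₁ μ₂ k m₂ m₃).charpoly = X * (X ^ 4 + C (2 * (h ^ 2 * (1 + t₁ ^ 2))) * X ^ 2 +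
      C ((h ^ 2 * (1 + t₁ ^ 2)) ^ 2 *
        (1 - 4 * (t₁ ^ 2 / (1 + t₁ ^ 2)) * (t₂ ^ 2 / (1 + t₂ ^ 2))))) := by
  have hs : t₁ + t₂ ≠ 0 := by positivity
  have h1 : 1 + t₁ ^ 2 ≠ 0 := by positivity
  have h2 : 1 + t₂ ^ 2 ≠ 0 := by positivity
  have hζ0 : ζ ≠ 0 := by rw [hζ]; positivity
  have i1 : 1 / μ₁ = t₁ / (ζ * (1 + t₁ ^ 2)) := by rw [hμ₁, one_div_div]
  have i2 : 1 / μ₂ = t₂ / (ζ * (1 + t₂ ^ 2)) := by rw [hμ₂, one_div_div]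
  rw [cotMatrix, charpoly_antiBlock]
  simp only [Matrix.cons_val]
  have key : ∀ a b c d : ℝ, a = -c → b = d →
      (X : ℝ[X]) * (X ^ 4 - C a * X ^ 2 + C b) = X * (X ^ 4 + C c * X ^ 2 + C d) := by
    rintro a b c d rfl rfl
    simp
  refine key _ _ _ _ ?_ ?_
  -- After substitution both coefficients are rational functions of `t₁, t₂, h`.
  all_goals
    subst hm₂ hm₃ hμ₁ hμ₂ hk hζ
    field_simp
    ring

/-! ### Reading stability off the characteristic polynomial. -/

section Spectrum

variable {L : Matrix (Fin 5) (Fin 5) ℂ} {w x : ℝ}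

open Polynomial in
/-- The shape of the characteristic polynomial of the linearization: `0`, and the square roots of
`w² (-1 ± x)`. -/
def HasBiquadraticCharpoly (L : Matrix (Fin 5) (Fin 5) ℂ) (w x : ℝ) : Prop :=
  L.charpoly = X * ((X ^ 2 + C ((w ^ 2 * (1 - x) : ℝ) : ℂ)) *
    (X ^ 2 + C ((w ^ 2 * (1 + x) : ℝ) : ℂ)))

theorem HasBiquadraticCharpoly.hasEigenvalue_iff (h : HasBiquadraticCharpoly L w x) (z : ℂ) :
    Module.End.HasEigenvalue (Matrix.toLin' L) z ↔
      z = 0 ∨ z ^ 2 = -((w ^ 2 * (1 - x) : ℝ) : ℂ) ∨ z ^ 2 = -((w ^ 2 * (1 + x) : ℝ) : ℂ) := by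
  rw [Module.End.hasEigenvalue_iff_isRoot_charpoly, Matrix.charpoly_toLin', h,
    Polynomial.IsRoot.def]
  simp [eq_neg_iff_add_eq_zero]

theorem HasBiquadraticCharpoly.exists_re_pos (h : HasBiquadraticCharpoly L w x) (hw : 0 < w)
    (hx : 1 < x) : ∃ z : ℂ, Module.End.HasEigenvalue (Matrix.toLin' L) z ∧ 0 < z.re := by
  have h1 : 0 < w ^ 2 * (x - 1) := mul_pos (by positivity) (by linarith)
  refine ⟨(√(w ^ 2 * (x - 1)) : ℝ), (h.hasEigenvalue_iff _).2 (Or.inr (Or.inl ?_)),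
    by simpa using h1⟩
  rw [← Complex.ofReal_pow, sq_sqrt h1.le, ← Complex.ofReal_neg]
  congr 1
  ring

theorem re_eq_zero_of_sq_eq_neg {z : ℂ} {r : ℝ} (hr : 0 ≤ r) (h : z ^ 2 = -(r : ℂ)) : z.re = 0 := by
  have h1 := congrArg Complex.re h
  have h2 := congrArg Complex.im h
  simp [sq] at h1 h2
  rcases mul_eq_zero.1 (show z.re * z.im = 0 by linarith) with h2 | h2
  · exact h2
  · rw [h2] at h1
    nlinarith [sq_nonneg z.re]

open Polynomial in
theorem HasBiquadraticCharpoly.elliptic (h : HasBiquadraticCharpoly L w x) (hw : 0 < w)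
    (hx : 0 < x) (hx1 : x < 1) :
    (∀ z : ℂ, Module.End.HasEigenvalue (Matrix.toLin' L) z → z.re = 0) ∧
    Module.End.IsSemisimple (Matrix.toLin' L) ∧ L.charpoly.rootMultiplicity 0 = 1 := by
  have hr : 0 < w ^ 2 * (1 - x) := mul_pos (by positivity) (by linarith)
  have hs : 0 < w ^ 2 * (1 + x) := by positivity
  have hrs : w ^ 2 * (1 + x) - w ^ 2 * (1 - x) ≠ 0 := by
    have : 0 < w ^ 2 * x := by positivity
    intro h; nlinarith
  generalize hR : w ^ 2 * (1 - x) = r at *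
  generalize hS : w ^ 2 * (1 + x) = s at *
  have hr' : (r : ℂ) ≠ 0 := by exact_mod_cast hr.ne'
  have hs' : (s : ℂ) ≠ 0 := by exact_mod_cast hs.ne'
  have hrs' : (s : ℂ) - r ≠ 0 := by exact_mod_cast hrs
  have hch : L.charpoly = X * ((X ^ 2 + C (r : ℂ)) * (X ^ 2 + C (s : ℂ))) := by
    rw [h, hR, hS]
  have sep : ∀ c : ℂ, c ≠ 0 → (X ^ 2 + C c).Separable := by
    intro c hc
    have h1 := separable_X_pow_sub_C (-c) (n := 2) (by norm_num) (neg_ne_zero.2 hc)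
    simpa using h1
  have cop : ∀ c : ℂ, c ≠ 0 → IsCoprime X (X ^ 2 + C c) := by
    intro c hc
    refine ⟨-C c⁻¹ * X, C c⁻¹, ?_⟩
    have h1 : C c⁻¹ * C c = (1 : ℂ[X]) := by rw [← C_mul, inv_mul_cancel₀ hc, C_1]
    linear_combination h1
  have cop2 : IsCoprime (X ^ 2 + C (r : ℂ)) (X ^ 2 + C (s : ℂ)) := by
    refine ⟨-C ((s : ℂ) - r)⁻¹, C ((s : ℂ) - r)⁻¹, ?_⟩
    have h1 : C ((s : ℂ) - r)⁻¹ * (C (s : ℂ) - C (r : ℂ)) = (1 : ℂ[X]) := by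
      rw [← C_sub, ← C_mul, inv_mul_cancel₀ hrs', C_1]
    linear_combination h1
  -- The bounds `0 < x < 1` make the five roots distinct. Separability yields both semisimplicity
  -- and the simplicity of `0`.
  have hsep : L.charpoly.Separable := by
    rw [hch]
    exact separable_X.mul ((sep _ hr').mul (sep _ hs') cop2) ((cop _ hr').mul_right (cop _ hs'))
  refine ⟨fun z hz => ?_, ?_, ?_⟩
  · rcases (h.hasEigenvalue_iff z).1 hz with h1 | h1 | h1
    · rw [h1, Complex.zero_re]
    · exact re_eq_zero_of_sq_eq_neg hr.le (by rw [h1, hR])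
    · exact re_eq_zero_of_sq_eq_neg hs.le (by rw [h1, hS])
  · refine Module.End.isSemisimple_of_squarefree_aeval_eq_zero hsep.squarefree ?_
    rw [← Matrix.charpoly_toLin']
    exact LinearMap.aeval_self_charpoly _
  · refine le_antisymm (rootMultiplicity_le_one_of_separable hsep 0) ?_
    rw [Nat.one_le_iff_ne_zero, ← Nat.pos_iff_ne_zero, rootMultiplicity_pos hsep.ne_zero, hch]
    simp

end Spectrum

/-! ### Relative equilibria in reduced coordinates. -/

theorem deriv_cot {q : ℝ} (hq : sin q ≠ 0) : deriv Real.cot q = -(1 / sin q ^ 2) := by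
  rw [(hasDerivAt_cot hq).deriv, cot_eq_cos_div_sin]
  have := sin_sq_add_cos_sq q
  field_simp
  linarith

theorem isRepelling_cot : IsRepelling Real.cot := by
  have hs : ∀ q ∈ Ioo 0 π, sin q ≠ 0 := fun q hq => (sin_pos_of_mem_Ioo hq).ne'
  constructor
  · have h1 : Real.cot = fun x => cos x / sin x := funext fun x => cot_eq_cos_div_sin x
    rw [h1]
    exact contDiff_cos.contDiffOn.div contDiff_sin.contDiffOn hs
  · intro q hq
    rw [deriv_cot (hs q hq), neg_lt_zero]
    have := sin_pos_of_mem_Ioo hq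
    positivity

/-- The velocities are normal to the plane of the particles and the angular momentum lies in it,
hence `p = m₁ = 0`. -/
theorem reducedState_eq {μ₁ μ₂ q a b : ℝ} {x₁ x₂ : ℝ → E3} {x y ω : E3}
    (h1 : x₁ 0 = x) (h2 : x₂ 0 = y) (hx : ‖x‖ = 1) (hy : ‖y‖ = 1)
    (hq : geoDist x y = q) (hqm : q ∈ Ioo 0 π) (hω : ω = a • x + b • y)
    (hd₁ : deriv x₁ 0 = cross ω x) (hd₂ : deriv x₂ 0 = cross ω y) :
    reducedState μ₁ μ₂ x₁ x₂ 0 =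
      ![q, 0, 0, sin q * (μ₁ * b - μ₂ * a * cos q), -(μ₂ * a * sin q ^ 2)] := by
  have hs : 0 < sin q := sin_pos_of_mem_Ioo hqm
  have hsc := sin_sq_add_cos_sq q
  have hc : inner ℝ x y = cos q := by rw [← hq, cos_geoDist hx hy]
  have hc' : inner ℝ y x = cos q := by rw [real_inner_comm, hc]
  have hxx : inner ℝ x x = 1 := by rw [real_inner_self_eq_norm_sq, hx, one_pow]
  have hyy : inner ℝ y y = 1 := by rw [real_inner_self_eq_norm_sq, hy, one_pow]
  have hJ₁ : cross x (cross ω x) = b • (y - cos q • x) := by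
    rw [cross_cross_right, hω, hxx, inner_add_right, real_inner_smul_right, real_inner_smul_right,
      hxx, hc]
    module
  have hJ₂ : cross y (cross ω y) = a • (x - cos q • y) := by
    rw [cross_cross_right, hω, hyy, inner_add_right, real_inner_smul_right, real_inner_smul_right,
      hyy, hc']
    module
  have hn : cross ω y = a • cross x y := by
    rw [hω]
    apply ext_coords <;>
    simp [cross_apply_zero, cross_apply_one, cross_apply_two] <;> ring
  have he : cross ((1 / sin q) • (y - cos q • x)) (-x) = (1 / sin q) • cross x y := by
    apply ext_coords <;>
    simp [cross_apply_zero, cross_apply_one, cross_apply_two] <;> ring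
  have n1 : inner ℝ x (cross x y) = 0 := by rw [real_inner_comm, inner_cross_self_left]
  have n2 : inner ℝ y (cross x y) = 0 := by rw [real_inner_comm, inner_cross_self_right]
  rw [reducedState, h1, h2, hq, hd₁, hd₂, hJ₁, hJ₂]
  simp only [he]
  rw [hn]
  simp only [inner_add_left, inner_add_right, inner_sub_left, inner_sub_right, inner_neg_right,
    real_inner_smul_left, real_inner_smul_right, inner_cross_self_left, inner_cross_self_right, n1,
    n2, hc, hc', hxx, hyy]
  have e3 : sin q ^ 2 = 1 - cos q ^ 2 := by linarith
  congr 1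
  simp only [Matrix.vecCons_inj, and_true]
  refine ⟨by ring, by ring, ?_, ?_⟩
  · field_simp
    rw [e3]
    ring
  · rw [e3]
    ring

/-- Passes from `a, b` to the tangents of the axis angles, the parameters of `charpoly_cotMatrix`.
Here `A, B` stand for the components of `ω` along the particles. -/
theorem tan_param {a b c s A B w μ₁ μ₂ : ℝ} (hA : a + b * c = A) (hB : b + a * c = B)
    (hsc : s ^ 2 + c ^ 2 = 1) (hs : 0 < s) (hbA : b * A < 0) (haB : a * B < 0)
    (hw : 0 < w) (hw2 : w ^ 2 = a ^ 2 + b ^ 2 + 2 * (a * b) * c)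
    (h₁ : μ₁ * A * b * s = -(1 / s ^ 2)) (h₂ : μ₂ * B * a * s = -(1 / s ^ 2)) :
    ∃ t₁ t₂ h ζ : ℝ, 0 < t₁ ∧ 0 < t₂ ∧ h ≠ 0 ∧ c / s = (t₁ * t₂ - 1) / (t₁ + t₂) ∧
      ζ = (1 + t₂ ^ 2) / (h ^ 2 * (t₁ + t₂) ^ 2) ∧ μ₁ = ζ * (1 + t₁ ^ 2) / t₁ ∧
      μ₂ = ζ * (1 + t₂ ^ 2) / t₂ ∧ -(μ₂ * a * s ^ 2) = h * ζ * (t₁ + t₂) ∧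
      s * (μ₁ * b - μ₂ * a * c) = t₁ * -(μ₂ * a * s ^ 2) ∧ h ^ 2 * (1 + t₁ ^ 2) = w ^ 2 ∧
      t₁ ^ 2 / (1 + t₁ ^ 2) = (b * s / w) ^ 2 ∧ t₂ ^ 2 / (1 + t₂ ^ 2) = (a * s / w) ^ 2 := by
  have ha0 : a ≠ 0 := left_ne_zero_of_mul haB.ne
  have hb0 : b ≠ 0 := left_ne_zero_of_mul hbA.ne
  have hA0 : A ≠ 0 := right_ne_zero_of_mul hbA.ne
  have hB0 : B ≠ 0 := right_ne_zero_of_mul haB.ne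
  have hwA : A ^ 2 + (b * s) ^ 2 = w ^ 2 := by
    rw [hw2, ← hA]; linear_combination b ^ 2 * hsc
  have hwB : B ^ 2 + (a * s) ^ 2 = w ^ 2 := by
    rw [hw2, ← hB]; linear_combination a ^ 2 * hsc
  have hsum : -(b * s) / A + -(a * s) / B = -(s * w ^ 2) / (A * B) := by
    field_simp
    rw [hw2, ← hA, ← hB]; ring
  have hprod : -(b * s) / A * (-(a * s) / B) - 1 = -(c * w ^ 2) / (A * B) := by
    field_simp
    rw [hw2, ← hA, ← hB]; linear_combination a * b * hsc
  have ht1 : 1 + (-(b * s) / A) ^ 2 = w ^ 2 / A ^ 2 := by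
    rw [← hwA]; field_simp
  have ht2 : 1 + (-(a * s) / B) ^ 2 = w ^ 2 / B ^ 2 := by
    rw [← hwB]; field_simp
  have hμ₁ : μ₁ = -1 / (A * b * s ^ 3) := by
    rw [eq_div_iff (by positivity)]
    field_simp at h₁
    linear_combination h₁
  have hμ₂ : μ₂ = -1 / (B * a * s ^ 3) := by
    rw [eq_div_iff (by positivity)]
    field_simp at h₂
    linear_combination h₂
  -- `t₁, t₂` are the tangents, positive because `b A` and `a B` are negative; `h = -A`, and `ζ =
  -- -V'(q) / w²` with `V' = -1 / s²`.
  refine ⟨-(b * s) / A, -(a * s) / B, -A, 1 / (s ^ 2 * w ^ 2),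
    ?_, ?_, neg_ne_zero.2 hA0, ?_, ?_, ?_,
    ?_, ?_, ?_, ?_, ?_, ?_⟩
  · rw [show -(b * s) / A = -(b * A) * s / A ^ 2 by field_simp]
    exact div_pos (mul_pos (neg_pos.2 hbA) hs) (by positivity)
  · rw [show -(a * s) / B = -(a * B) * s / B ^ 2 by field_simp]
    exact div_pos (mul_pos (neg_pos.2 haB) hs) (by positivity)
  · rw [hsum, hprod]
    field_simp
  · rw [hsum, ht2]
    field_simp
  · rw [ht1, hμ₁]
    field_simp
  · rw [ht2, hμ₂]
    field_simp
  · rw [hsum, hμ₂]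
    field_simp
  · rw [hμ₁, hμ₂]
    field_simp
    rw [← hA, ← hB]
    linear_combination b * hsc
  · rw [ht1]
    field_simp
  · rw [ht1]
    field_simp
  · rw [ht2]
    field_simp

/-- The characteristic polynomial of the linearization at a relative equilibrium for the potential
`cot`, in terms of the angles between the axis and the particles. -/
theorem IsRE.exists_charpoly {μ₁ μ₂ : ℝ} (hμ₁ : 0 < μ₁) (hμ₂ : 0 < μ₂) {x₁ x₂ : ℝ → E3}
    (h : IsRE μ₁ μ₂ Real.cot x₁ x₂) :
    ∃ θ₁ θ₂ w : ℝ, θ₁ ∈ Ioo 0 (π / 2) ∧ θ₂ ∈ Ioo 0 (π / 2) ∧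
      geoDist (x₁ 0) (x₂ 0) = π - (θ₁ + θ₂) ∧ μ₁ * sin (2 * θ₁) = μ₂ * sin (2 * θ₂) ∧ 0 < w ∧
      HasBiquadraticCharpoly (linearization μ₁ μ₂ Real.cot (reducedState μ₁ μ₂ x₁ x₂ 0)) w
        (2 * sin θ₁ * sin θ₂) := by
  obtain ⟨hm, ω, hr⟩ := h
  obtain ⟨a, b, hω, hB, hA, -, -⟩ := isRepelling_cot.axisAngles hμ₁ hm hr
  have hq := hm.dist_mem 0
  have hF := isRepelling_cot.2 _ hq
  obtain ⟨hθ₁, hθ₂, hqθ, hsin⟩ := hB.axis_facts hA hμ₁ hμ₂ hq hF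
  refine ⟨_, _, ‖ω‖, hθ₁, hθ₂, hqθ, hsin, hA.speed_pos, ?_⟩
  have e1 : x₁ = fun t => rot ω t (x₁ 0) := funext fun t => (hr t).1
  have e2 : x₂ = fun t => rot ω t (x₂ 0) := funext fun t => (hr t).2
  have d1 : deriv x₁ 0 = cross ω (x₁ 0) := by
    rw [e1, deriv_rot]; rfl
  have d2 : deriv x₂ 0 = cross ω (x₂ 0) := by
    rw [e2, deriv_rot]; rfl
  have hs : 0 < sin (geoDist (x₁ 0) (x₂ 0)) := sin_pos_of_mem_Ioo hq
  rw [reducedState_eq rfl rfl (hm.sphere₁ 0) (hm.sphere₂ 0) rfl hq hω d1 d2,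
    linearization_cot hμ₁.ne' hμ₂.ne' hs.ne']
  have s1 := hA.sin₁ hq
  have s2 := hA.sin₂ hq
  have hw := hA.speed_pos
  have hw2 := hA.speed_sq
  have hb1 := hB.eq₁
  have hb2 := hB.eq₂
  rw [deriv_cot hs.ne'] at hb1 hb2
  obtain ⟨t₁, t₂, h, ζ, ht₁, ht₂, hh, hk, hζ, h1, h2, h3, h4, h5, h6, h7⟩ :=
    tan_param (c := cos (geoDist (x₁ 0) (x₂ 0))) (s := sin (geoDist (x₁ 0) (x₂ 0)))
      (μ₁ := μ₁) (μ₂ := μ₂) rfl rfl (sin_sq_add_cos_sq _) hs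
      (hB.mul_lt_zero₁ hμ₁ hq hF) (hB.mul_lt_zero₂ hμ₂ hq hF) hw hw2 hb1 hb2
  rw [← cot_eq_cos_div_sin] at hk
  have hch := charpoly_cotMatrix ht₁ ht₂ hh hk hζ h1 h2 h3 h4
  have S1 : sin (axisAngle ω (x₁ 0)) ^ 2 = (b * sin (geoDist (x₁ 0) (x₂ 0)) / ‖ω‖) ^ 2 := by
    rw [div_pow, eq_div_iff (by positivity), mul_comm, ← mul_pow, s1, mul_pow, sq_abs, mul_pow]
  have S2 : sin (axisAngle ω (x₂ 0)) ^ 2 = (a * sin (geoDist (x₁ 0) (x₂ 0)) / ‖ω‖) ^ 2 := by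
    rw [div_pow, eq_div_iff (by positivity), mul_comm, ← mul_pow, s2, mul_pow, sq_abs, mul_pow]
  rw [h5, h6, h7, ← S1, ← S2] at hch
  have hmap := Matrix.charpoly_map (cotMatrix μ₁ μ₂ (cot (geoDist (x₁ 0) (x₂ 0)))
    (sin (geoDist (x₁ 0) (x₂ 0)) * (μ₁ * b - μ₂ * a * cos (geoDist (x₁ 0) (x₂ 0))))
    (-(μ₂ * a * sin (geoDist (x₁ 0) (x₂ 0)) ^ 2))) Complex.ofRealHom
  rw [hch] at hmap
  rw [HasBiquadraticCharpoly]
  refine hmap.trans ?_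
  simp only [Polynomial.map_mul, Polynomial.map_X, Polynomial.map_add, Polynomial.map_pow,
    Polynomial.map_C, Complex.ofRealHom_eq_coe]
  simp only [Complex.ofReal_mul, Complex.ofReal_add, Complex.ofReal_sub, Complex.ofReal_pow,
    map_mul, map_add, map_sub, map_pow, Complex.ofReal_one, Complex.ofReal_ofNat, map_one]
  have C2 : (Polynomial.C (2 : ℂ)) = 2 := rfl
  have C4 : (Polynomial.C (4 : ℂ)) = 4 := rfl
  rw [C2, C4]
  ring

/-! ### Monotonicity along the acute branch. -/

theorem two_mul_sin_mul_sin (x y : ℝ) : 2 * sin x * sin y = cos (x - y) - cos (x + y) := by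
  rw [cos_sub, cos_add]; ring

/-- The angles between the axis and the particles of masses `m < M` in an acute relative equilibrium
with separation `q`. -/
structure AcuteAngles (m M q x y : ℝ) : Prop where
  memx : x ∈ Ioo 0 (π / 2)
  memy : y ∈ Ioo 0 (π / 2)
  dist_eq : q = π - (x + y)
  acute : q < π / 2
  sin_eq : m * sin (2 * x) = M * sin (2 * y)

namespace AcuteAngles

variable {m M q x y q' x' y' : ℝ}

theorem lt (h : AcuteAngles m M q x y) (hm : 0 < m) (hM : m < M) : x < y :=
  lt_of_sin_two_mul_lt h.memx h.memy (by linarith [h.dist_eq, h.acute])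
    (sin_two_mul_lt_of_mass_lt hM (sin_two_mul_pos h.memx) (hm.trans hM) h.sin_eq)

/-- Writing `2x` and `2y` as `(x + y) ∓ (y - x)` turns the mass relation into one between `q` and `y
- x`, which therefore increase together. -/
theorem tan_eq (h : AcuteAngles m M q x y) (hm : 0 < m) (hM : m < M) :
    (M + m) * tan (y - x) = (M - m) * tan q := by
  have hxy := h.lt hm hM
  have hq : 0 < cos q := cos_pos_of_mem_Ioo
    ⟨by linarith [h.dist_eq, h.memx.2, h.memy.2, pi_pos], h.acute⟩
  have hd : 0 < cos (y - x) := cos_pos_of_mem_Ioo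
    ⟨by linarith [pi_pos], by linarith [h.memx.1, h.memy.2]⟩
  have e1 : sin (2 * x) = sin (x + y) * cos (y - x) - cos (x + y) * sin (y - x) := by
    rw [← sin_sub]; ring_nf
  have e2 : sin (2 * y) = sin (x + y) * cos (y - x) + cos (x + y) * sin (y - x) := by
    rw [← sin_add]; ring_nf
  have e3 : sin (x + y) = sin q := by rw [h.dist_eq, sin_pi_sub]
  have e4 : cos (x + y) = -cos q := by rw [h.dist_eq, cos_pi_sub, neg_neg]
  have e5 := h.sin_eq
  rw [e1, e2, e3, e4] at e5
  rw [tan_eq_sin_div_cos, tan_eq_sin_div_cos]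
  field_simp
  linear_combination e5

theorem two_sin_eq (h : AcuteAngles m M q x y) : 2 * sin x * sin y = cos (y - x) + cos q := by
  rw [two_mul_sin_mul_sin, h.dist_eq, cos_pi_sub, ← cos_neg, neg_sub]; ring

/-- The product of the sines of the two angles decreases with the separation. -/
theorem two_sin_lt (h : AcuteAngles m M q x y) (h' : AcuteAngles m M q' x' y') (hm : 0 < m)
    (hM : m < M) (hq : q < q') : 2 * sin x' * sin y' < 2 * sin x * sin y := by
  have hxy := h.lt hm hM
  have hxy' := h'.lt hm hM
  have q0 : 0 < q := by linarith [h.dist_eq, h.memx.2, h.memy.2]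
  have ht : tan q < tan q' := tan_lt_tan_of_nonneg_of_lt_pi_div_two q0.le h'.acute hq
  have ht2 : tan (y - x) < tan (y' - x') := by
    have h1 : (M + m) * tan (y - x) < (M + m) * tan (y' - x') := by
      rw [h.tan_eq hm hM, h'.tan_eq hm hM]
      exact mul_lt_mul_of_pos_left ht (by linarith)
    exact lt_of_mul_lt_mul_left h1 (by linarith)
  have hd : y - x < y' - x' := by
    by_contra hc
    rcases (not_lt.1 hc).eq_or_lt with h1 | h1
    · rw [h1] at ht2; exact ht2.false
    · exact ht2.not_gt (tan_lt_tan_of_nonneg_of_lt_pi_div_two (by linarith)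
        (by linarith [h.memx.1, h.memy.2]) h1)
  -- Both `q` and the difference of the angles have grown, so both cosines decrease.
  rw [h.two_sin_eq, h'.two_sin_eq]
  have c1 : cos (y' - x') < cos (y - x) := cos_lt_cos_of_nonneg_of_le_pi (by linarith)
    (by linarith [h'.memx.1, h'.memy.2, pi_pos]) hd
  have c2 : cos q' < cos q := cos_lt_cos_of_nonneg_of_le_pi q0.le
    (by linarith [h'.acute, pi_pos]) hq
  linarith

end AcuteAngles

/-! ### The critical angle. -/

namespace IsCriticalAlpha

variable {μ α β : ℝ}

theorem one_sub_pos (hμ : 0 < μ) (hμ1 : μ < 1) (x : ℝ) : 0 < 1 - μ ^ 2 * sin x ^ 2 := by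
  have h1 := sin_sq_le_one x
  have h2 : μ ^ 2 * sin x ^ 2 ≤ μ ^ 2 := mul_le_of_le_one_right (by positivity) h1
  nlinarith

/-- The difference of the two sides is negative at `3π/4`, where `cos 2α = 0`, and equals `1` at
`π`. -/
theorem exists_isCriticalAlpha (hμ : 0 < μ) (hμ1 : μ < 1) : ∃ α, IsCriticalAlpha μ α := by
  have hcont : ContinuousOn
      (fun α : ℝ => cos (2 * α) - 2 * sin α ^ 2 * √(1 - μ ^ 2 * sin (2 * α) ^ 2))
      (Icc (3 * π / 4) π) := by fun_prop
  have hlt : 3 * π / 4 < π := by linarith [pi_pos]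
  have h0 : (0 : ℝ) ∈ Ioo
      ((fun α : ℝ => cos (2 * α) - 2 * sin α ^ 2 * √(1 - μ ^ 2 * sin (2 * α) ^ 2)) (3 * π / 4))
      ((fun α : ℝ => cos (2 * α) - 2 * sin α ^ 2 * √(1 - μ ^ 2 * sin (2 * α) ^ 2)) π) := by
    constructor
    · have h1 : cos (2 * (3 * π / 4)) = 0 := by
        rw [show 2 * (3 * π / 4) = π / 2 + π by ring, cos_add_pi, cos_pi_div_two, neg_zero]
      have h2 : 0 < sin (3 * π / 4) := sin_pos_of_pos_of_lt_pi (by positivity) hlt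
      have h3 := sqrt_pos.2 (one_sub_pos hμ hμ1 (2 * (3 * π / 4)))
      have : 0 < 2 * sin (3 * π / 4) ^ 2 * √(1 - μ ^ 2 * sin (2 * (3 * π / 4)) ^ 2) := by positivity
      simp only [h1]
      linarith
    · simp
  obtain ⟨α, hα, h⟩ := intermediate_value_Ioo hlt.le hcont h0
  exact ⟨α, ⟨by linarith [hα.1, pi_pos], hα.2⟩, sub_eq_zero.1 h⟩

theorem sin_pos (h : IsCriticalAlpha μ α) : 0 < sin α :=
  sin_pos_of_pos_of_lt_pi (by linarith [h.1.1, pi_pos]) h.1.2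

theorem cos_two_mul_pos (h : IsCriticalAlpha μ α) (hμ : 0 < μ) (hμ1 : μ < 1) :
    0 < cos (2 * α) := by
  rw [h.2]
  have := h.sin_pos
  have := sqrt_pos.2 (one_sub_pos hμ hμ1 (2 * α))
  positivity

theorem gt (h : IsCriticalAlpha μ α) (hμ : 0 < μ) (hμ1 : μ < 1) : 3 * π / 4 < α := by
  by_contra hc
  exact (h.cos_two_mul_pos hμ hμ1).not_ge
    (cos_nonpos_of_pi_div_two_le_of_le (by linarith [h.1.1, pi_pos]) (by linarith))

/-- Squaring gives a polynomial equation in `u = sin² α`, from which `μ²` can be eliminated between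
two solutions. -/
theorem sin_sq_equation (h : IsCriticalAlpha μ α) (hμ : 0 < μ) (hμ1 : μ < 1) :
    16 * μ ^ 2 * ((sin α ^ 2) ^ 3 * (1 - sin α ^ 2)) = 4 * sin α ^ 2 - 1 := by
  have h1 := congrArg (fun x => x ^ 2) h.2
  simp only [mul_pow, sq_sqrt (one_sub_pos hμ hμ1 (2 * α)).le] at h1
  rw [cos_two_mul, sin_two_mul] at h1
  have h2 := cos_sq' α
  rw [mul_pow, mul_pow, h2] at h1
  linear_combination h1

theorem sin_sq_lt (h : IsCriticalAlpha μ α) (hμ : 0 < μ) (hμ1 : μ < 1) : sin α ^ 2 < 1 / 2 := by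
  have h1 := h.cos_two_mul_pos hμ hμ1
  rw [cos_two_mul, cos_sq'] at h1
  linarith

theorem eq_of_cross_eq {u v : ℝ} (hu : 0 < u) (hu2 : u < 1 / 2) (hv : 0 < v) (hv2 : v < 1 / 2)
    (h : (4 * u - 1) * (v ^ 3 * (1 - v)) = (4 * v - 1) * (u ^ 3 * (1 - u))) : u = v := by
  have h1 : (u - v) * ((u ^ 2 + u * v + v ^ 2) * (1 + 4 * (u * v)) -
      (u + v) * (u ^ 2 + v ^ 2 + 4 * (u * v))) = 0 := by linear_combination h
  rcases mul_eq_zero.1 h1 with h2 | h2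
  · exact sub_eq_zero.1 h2
  · exfalso
    have hp : 0 < u * v := mul_pos hu hv
    have hp4 : 4 * (u * v) ≤ (u + v) ^ 2 := by nlinarith [sq_nonneg (u - v)]
    -- With `s = u + v < 1`, `p = u v` and `4p ≤ s²`, the cofactor of `u - v` equals `(1 - s)(s² -
    -- p(3s + 1)) + p(s² - 4p)`, which is positive.
    have h3 : 0 < (1 - (u + v)) * ((u + v) ^ 2 - u * v * (3 * (u + v) + 1)) := by
      refine mul_pos (by linarith) ?_
      have : u * v * (3 * (u + v) + 1) < u * v * 4 := mul_lt_mul_of_pos_left (by linarith) hp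
      linarith
    have h4 : 0 ≤ u * v * ((u + v) ^ 2 - 4 * (u * v)) := mul_nonneg hp.le (by linarith)
    nlinarith

theorem unique (h : IsCriticalAlpha μ α) (h' : IsCriticalAlpha μ β) (hμ : 0 < μ) (hμ1 : μ < 1) :
    β = α := by
  have e := h.sin_sq_equation hμ hμ1
  have e' := h'.sin_sq_equation hμ hμ1
  have s := h.sin_pos
  have s' := h'.sin_pos
  have h1 : sin β ^ 2 = sin α ^ 2 :=
    eq_of_cross_eq (by positivity) (h'.sin_sq_lt hμ hμ1) (by positivity) (h.sin_sq_lt hμ hμ1)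
      (by rw [← e, ← e']; ring)
  have h2 : sin β = sin α := (pow_left_inj₀ s'.le s.le two_ne_zero).1 h1
  have h3 : sin (π - β) = sin (π - α) := by rw [sin_pi_sub, sin_pi_sub, h2]
  have h4 := injOn_sin ⟨by linarith [h'.1.2, pi_pos], by linarith [h'.1.1]⟩
    ⟨by linarith [h.1.2, pi_pos], by linarith [h.1.1]⟩ h3
  linarith

theorem sin_two_mul_neg (h : IsCriticalAlpha μ α) : sin (2 * α) < 0 := by
  rw [sin_two_mul]
  have h1 : cos α < 0 := cos_neg_of_pi_div_two_lt_of_lt h.1.1 (by linarith [h.1.2, pi_pos])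
  have := h.sin_pos
  nlinarith

/-- The lower bound says that the critical separation is below `π/2`, the upper one that the larger
mass makes an angle below `π/2` with the axis. -/
theorem arcsin_bounds (h : IsCriticalAlpha μ α) (hμ : 0 < μ) (hμ1 : μ < 1) :
    2 * α - 2 * π < arcsin (μ * sin (2 * α)) ∧ arcsin (μ * sin (2 * α)) < 0 := by
  have h1 := h.sin_two_mul_neg
  have h2 := h.gt hμ hμ1
  constructor
  · rw [lt_arcsin_iff_sin_lt' ⟨by linarith, by linarith [h.1.2, pi_pos]⟩, sin_sub_two_pi]
    nlinarith
  · exact arcsin_lt_zero.2 (mul_neg_of_pos_of_neg hμ h1)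

/-- The relative equilibrium at the loss of stability. -/
theorem acuteAngles {m M : ℝ} (hm : 0 < m) (hM : m < M) (h : IsCriticalAlpha (m / M) α) :
    AcuteAngles m M (α - π / 2 - 1 / 2 * arcsin (m / M * sin (2 * α))) (π - α)
      (π / 2 + 1 / 2 * arcsin (m / M * sin (2 * α))) := by
  have hM0 : 0 < M := hm.trans hM
  have hμ : 0 < m / M := by positivity
  have hμ1 : m / M < 1 := (div_lt_one hM0).2 hM
  have hg := h.gt hμ hμ1
  obtain ⟨h1, h2⟩ := h.arcsin_bounds hμ hμ1
  refine ⟨⟨by linarith [h.1.2], by linarith [h.1.1]⟩, ⟨by linarith, by linarith⟩, by ring,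
    by linarith, ?_⟩
  have hb : |m / M * sin (2 * α)| ≤ 1 := by
    rw [abs_mul, abs_of_pos hμ]
    exact mul_le_one₀ hμ1.le (abs_nonneg _) (abs_sin_le_one _)
  rw [show 2 * (π / 2 + 1 / 2 * arcsin (m / M * sin (2 * α))) =
      arcsin (m / M * sin (2 * α)) + π by ring, sin_add_pi,
    sin_arcsin (abs_le.1 hb).1 (abs_le.1 hb).2,
    show 2 * (π - α) = 2 * π - 2 * α by ring, sin_two_pi_sub]
  field_simp

/-- For `y` the angle of the larger mass, `(2 sin α sin y)² = 2 sin² α (1 - cos 2y)` and `cos 2y =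
-√(1 - μ² sin² 2α)`, so the critical equation says that this square is `1`. -/
theorem two_sin_eq_one {m M : ℝ} (hm : 0 < m) (hM : m < M) (h : IsCriticalAlpha (m / M) α) :
    2 * sin (π - α) * sin (π / 2 + 1 / 2 * arcsin (m / M * sin (2 * α))) = 1 := by
  have hA := h.acuteAngles hm hM
  have s1 : 0 < sin (π - α) := sin_pos_of_mem_Ioo ⟨hA.memx.1, by linarith [hA.memx.2, pi_pos]⟩
  have s2 : 0 < sin (π / 2 + 1 / 2 * arcsin (m / M * sin (2 * α))) :=
    sin_pos_of_mem_Ioo ⟨hA.memy.1, by linarith [hA.memy.2, pi_pos]⟩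
  have e1 : cos (2 * (π / 2 + 1 / 2 * arcsin (m / M * sin (2 * α)))) =
      -√(1 - (m / M) ^ 2 * sin (2 * α) ^ 2) := by
    rw [show 2 * (π / 2 + 1 / 2 * arcsin (m / M * sin (2 * α))) =
      arcsin (m / M * sin (2 * α)) + π by ring, cos_add_pi, cos_arcsin, mul_pow]
  have e2 := h.2
  rw [cos_two_mul, cos_sq'] at e1 e2
  have e3 : (2 * sin (π - α) * sin (π / 2 + 1 / 2 * arcsin (m / M * sin (2 * α)))) ^ 2 = 1 := by
    rw [sin_pi_sub]
    linear_combination (-2 * sin α ^ 2) * e1 - e2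
  exact (pow_eq_one_iff_of_nonneg (by positivity) two_ne_zero).1 e3

theorem dist_mem {m M : ℝ} (hm : 0 < m) (hM : m < M) (h : IsCriticalAlpha (m / M) α) :
    α - π / 2 - 1 / 2 * arcsin (m / M * sin (2 * α)) ∈ Ioo 0 (π / 2) := by
  have hA := h.acuteAngles hm hM
  exact ⟨by linarith [hA.dist_eq, hA.memx.2, hA.memy.2], hA.acute⟩

end IsCriticalAlpha

/-! ### Stability of the relative equilibria. -/

theorem IsRE.isElliptic_of_obtuse {μ₁ μ₂ : ℝ} (hμ₁ : 0 < μ₁) (hμ₂ : 0 < μ₂) {x₁ x₂ : ℝ → E3}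
    (h : IsRE μ₁ μ₂ Real.cot x₁ x₂) (hq : π / 2 < geoDist (x₁ 0) (x₂ 0)) :
    IsElliptic μ₁ μ₂ Real.cot x₁ x₂ := by
  obtain ⟨x, y, w, hx, hy, hd, -, hw, hL⟩ := h.exists_charpoly hμ₁ hμ₂
  have s1 : 0 < sin x := sin_pos_of_mem_Ioo ⟨hx.1, by linarith [hx.2, pi_pos]⟩
  have s2 : 0 < sin y := sin_pos_of_mem_Ioo ⟨hy.1, by linarith [hy.2, pi_pos]⟩
  refine hL.elliptic hw (by positivity) ?_
  rw [two_mul_sin_mul_sin]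
  have h1 : 0 < cos (x + y) := cos_pos_of_mem_Ioo ⟨by linarith [hx.1, hy.1, pi_pos], by linarith⟩
  linarith [cos_le_one (x - y)]

theorem IsRE.exists_acuteAngles {μ₁ μ₂ : ℝ} (hμ₁ : 0 < μ₁) (hμ₂ : 0 < μ₂) {x₁ x₂ : ℝ → E3}
    (h : IsRE μ₁ μ₂ Real.cot x₁ x₂) (hq : geoDist (x₁ 0) (x₂ 0) < π / 2) :
    ∃ x y w : ℝ, AcuteAngles (min μ₁ μ₂) (max μ₁ μ₂) (geoDist (x₁ 0) (x₂ 0)) x y ∧ 0 < w ∧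
      HasBiquadraticCharpoly (linearization μ₁ μ₂ Real.cot (reducedState μ₁ μ₂ x₁ x₂ 0)) w
        (2 * sin x * sin y) := by
  obtain ⟨x, y, w, hx, hy, hd, hs, hw, hL⟩ := h.exists_charpoly hμ₁ hμ₂
  rcases le_total μ₁ μ₂ with hle | hle
  · rw [min_eq_left hle, max_eq_right hle]
    exact ⟨x, y, w, ⟨hx, hy, hd, hq, hs⟩, hw, hL⟩
  · rw [min_eq_right hle, max_eq_left hle]
    refine ⟨y, x, w, ⟨hy, hx, by rw [hd, add_comm], hq, hs.symm⟩, hw, ?_⟩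
    rwa [mul_right_comm]

/-- By strict monotonicity in `q`, `2 sin θ₁ sin θ₂` is compared with its value `1` at the critical
pair of angles. -/
theorem exists_stability_threshold {μ₁ μ₂ : ℝ} (hμ₁ : 0 < μ₁) (hμ₂ : 0 < μ₂) (hne : μ₁ ≠ μ₂) :
    ∃ μ α qd : ℝ, μ = min μ₁ μ₂ / max μ₁ μ₂ ∧
      IsCriticalAlpha μ α ∧ (∀ β : ℝ, IsCriticalAlpha μ β → β = α) ∧
      qd = α - π / 2 - 1 / 2 * arcsin (μ * sin (2 * α)) ∧
      qd ∈ Ioo 0 (π / 2) ∧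
      ∀ x₁ x₂ : ℝ → E3, IsRE μ₁ μ₂ Real.cot x₁ x₂ →
        (geoDist (x₁ 0) (x₂ 0) < qd → IsLinearlyUnstable μ₁ μ₂ Real.cot x₁ x₂) ∧
        (qd < geoDist (x₁ 0) (x₂ 0) → geoDist (x₁ 0) (x₂ 0) < π / 2 →
          IsElliptic μ₁ μ₂ Real.cot x₁ x₂) := by
  have hm : 0 < min μ₁ μ₂ := lt_min hμ₁ hμ₂
  have hM : min μ₁ μ₂ < max μ₁ μ₂ := min_lt_max.2 hne
  have hμ : 0 < min μ₁ μ₂ / max μ₁ μ₂ := div_pos hm (hm.trans hM)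
  have hμ1 : min μ₁ μ₂ / max μ₁ μ₂ < 1 := (div_lt_one (hm.trans hM)).2 hM
  obtain ⟨α, hα⟩ := IsCriticalAlpha.exists_isCriticalAlpha hμ hμ1
  have hA := hα.acuteAngles hm hM
  have h1 := hα.two_sin_eq_one hm hM
  refine ⟨_, α, _, rfl, hα, fun β hβ => hα.unique hβ hμ hμ1, rfl, hα.dist_mem hm hM,
    fun x₁ x₂ hR => ⟨fun hq => ?_, fun hq hq2 => ?_⟩⟩
  · obtain ⟨x, y, w, hxy, hw, hL⟩ := hR.exists_acuteAngles hμ₁ hμ₂ (hq.trans hA.acute)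
    exact hL.exists_re_pos hw (h1 ▸ hxy.two_sin_lt hA hm hM hq)
  · obtain ⟨x, y, w, hxy, hw, hL⟩ := hR.exists_acuteAngles hμ₁ hμ₂ hq2
    have s1 : 0 < sin x := sin_pos_of_mem_Ioo ⟨hxy.memx.1, by linarith [hxy.memx.2, pi_pos]⟩
    have s2 : 0 < sin y := sin_pos_of_mem_Ioo ⟨hxy.memy.1, by linarith [hxy.memy.2, pi_pos]⟩
    exact hL.elliptic hw (by positivity) (h1 ▸ hA.two_sin_lt hxy hm hM hq)

end TwoBody

theorem theorem2 (μ₁ μ₂ : ℝ) (hμ₁ : 0 < μ₁) (hμ₂ : 0 < μ₂) (hne : μ₁ ≠ μ₂) :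
    (∀ V : ℝ → ℝ, TwoBody.IsRepelling V →
      -- existence and uniqueness for each separation other than a right angle
      (∀ q ∈ Ioo 0 π, q ≠ π / 2 →
        (∃ x₁ x₂ : ℝ → TwoBody.E3,
          TwoBody.IsRE μ₁ μ₂ V x₁ x₂ ∧ TwoBody.geoDist (x₁ 0) (x₂ 0) = q) ∧
        (∀ x₁ x₂ y₁ y₂ : ℝ → TwoBody.E3,
          TwoBody.IsRE μ₁ μ₂ V x₁ x₂ → TwoBody.geoDist (x₁ 0) (x₂ 0) = q →
          TwoBody.IsRE μ₁ μ₂ V y₁ y₂ → TwoBody.geoDist (y₁ 0) (y₂ 0) = q →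
          TwoBody.SameUpToSymmetry x₁ x₂ y₁ y₂)) ∧
      -- none at a right angle
      (¬ ∃ x₁ x₂ : ℝ → TwoBody.E3,
        TwoBody.IsRE μ₁ μ₂ V x₁ x₂ ∧ TwoBody.geoDist (x₁ 0) (x₂ 0) = π / 2) ∧
      -- the axis of rotation and the angular velocity
      (∀ (x₁ x₂ : ℝ → TwoBody.E3) (ω : TwoBody.E3) (q θ₁ θ₂ : ℝ),
        TwoBody.IsMotion μ₁ μ₂ V x₁ x₂ → TwoBody.RotatesWith ω x₁ x₂ →
        q = TwoBody.geoDist (x₁ 0) (x₂ 0) →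
        θ₁ = TwoBody.axisAngle ω (x₁ 0) → θ₂ = TwoBody.axisAngle ω (x₂ 0) →
        θ₁ ∈ Ioo 0 (π / 2) ∧ θ₂ ∈ Ioo 0 (π / 2) ∧
        q = π - (θ₁ + θ₂) ∧
        inner ℝ ω (x₁ 0) * inner ℝ ω (x₂ 0) < 0 ∧
        μ₁ * sin (2 * θ₁) = μ₂ * sin (2 * θ₂) ∧
        (q < π / 2 → (μ₁ < μ₂ → θ₁ < θ₂) ∧ (μ₂ < μ₁ → θ₂ < θ₁)) ∧
        (π / 2 < q → (μ₁ < μ₂ → θ₂ < θ₁) ∧ (μ₂ < μ₁ → θ₁ < θ₂)) ∧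
        ‖ω‖ ^ 2 = (1 / 2 * μ₁ * sin (2 * θ₁))⁻¹ * (- deriv V q) ∧
        ‖ω‖ ^ 2 = (1 / 2 * μ₂ * sin (2 * θ₂))⁻¹ * (- deriv V q))) ∧
    -- linear stability for the potential `cot`
    (∀ x₁ x₂ : ℝ → TwoBody.E3, TwoBody.IsRE μ₁ μ₂ Real.cot x₁ x₂ →
      π / 2 < TwoBody.geoDist (x₁ 0) (x₂ 0) → TwoBody.IsElliptic μ₁ μ₂ Real.cot x₁ x₂) ∧
    (∃ μ α qd : ℝ, μ = min μ₁ μ₂ / max μ₁ μ₂ ∧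
      TwoBody.IsCriticalAlpha μ α ∧ (∀ β : ℝ, TwoBody.IsCriticalAlpha μ β → β = α) ∧
      qd = α - π / 2 - 1 / 2 * arcsin (μ * sin (2 * α)) ∧
      qd ∈ Ioo 0 (π / 2) ∧
      ∀ x₁ x₂ : ℝ → TwoBody.E3, TwoBody.IsRE μ₁ μ₂ Real.cot x₁ x₂ →
        (TwoBody.geoDist (x₁ 0) (x₂ 0) < qd →
          TwoBody.IsLinearlyUnstable μ₁ μ₂ Real.cot x₁ x₂) ∧
        (qd < TwoBody.geoDist (x₁ 0) (x₂ 0) → TwoBody.geoDist (x₁ 0) (x₂ 0) < π / 2 →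
          TwoBody.IsElliptic μ₁ μ₂ Real.cot x₁ x₂)) := by
  refine ⟨fun V hV => ⟨fun q hq hq2 => ⟨hV.exists_isRE hμ₁ hμ₂ hq hq2, ?_⟩, ?_, ?_⟩, ?_, ?_⟩
  · exact fun x₁ x₂ y₁ y₂ hx hxq hy hyq =>
      hV.sameUpToSymmetry hμ₁ hμ₂ hne hx hy (hyq.trans hxq.symm)
  · rintro ⟨x₁, x₂, h, hq⟩
    exact hV.dist_ne_pi_div_two hμ₁ hne h hq
  · exact fun x₁ x₂ ω q θ₁ θ₂ hm hr hq h₁ h₂ => hV.axis_description hμ₁ hμ₂ hm hr hq h₁ h₂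
  · exact fun x₁ x₂ h hq => h.isElliptic_of_obtuse hμ₁ hμ₂ hq
  · exact TwoBody.exists_stability_threshold hμ₁ hμ₂ hne
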